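/- Let $S^1=[-1,1]/(-1\sim 1)$ with the arc-length distance $\operatorname{dist}$ (total length $2$) and normalized Lebesgue measure $m$. Let $f:S^1\to S^1$ be the map induced by $x\mapsto 2\sqrt{x}-1$ for $x\ge 0$ and $x\mapsto 1-2\sqrt{|x|}$ for $x<0$, and let $\mathcal S=\{0,\pm1\}\subset S^1$. Definitions. A finite set $\mathcal S\subset S^1$ is a non-degenerate exceptional set for $f$ with constants $B>1$, $\beta>0$ if $f$ is a $C^2$ local diffeomorphism at every point of $S^1\setminus\mathcal S$; for all $x\in S^1\setminus\mathcal S$, $$\tfrac1B\operatorname{dist}(x,\mathcal S)^{\beta}\le |f'(x)|\le B\operatorname{dist}(x,\mathcal S)^{-\beta};$$ and, for all $x,y\in S^1\setminus\mathcal S$ with $\operatorname{dist}(x,y)<\operatorname{dist}(x,\mathcal S)/2$, both $\bigl|\log|f'(x)^{-1}|-\log|f'(y)^{-1}|\bigr|$ and $\bigl|\log|f'(x)|-\log|f'(y)|\bigr|$ are at most $B\operatorname{dist}(x,\mathcal S)^{-\beta}\operatorname{dist}(x,y)$. Let $\operatorname{dist}_\delta(x,\mathcal S)$ be $\operatorname{dist}(x,\mathcal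 S)$ if this is $\le\delta$, and $1$ otherwise. Fix $0<b<\min\{1/2,1/(4\beta)\}$. For $0<\sigma<1$ and $\delta>0$, an integer $n\ge1$ is a $(\sigma,\delta)$-hyperbolic time for $x$ if for all $1\le k\le n$ $$\prod_{j=n-k}^{n-1}|f'(f^j(x))^{-1}|\le\sigma^k\quad\text{and}\quad \operatorname{dist}_\delta(f^{n-k}(x),\mathcal S)\ge\sigma^{bk}.$$ The frequency of $(\sigma,\delta)$-hyperbolic times for $x$ is greater than $\theta>0$ if, for all large $n$, at least $\theta n$ of the integers $1,\dots,n$ are $(\sigma,\delta)$-hyperbolic times for $x$. Let $h(x)=h_{\sigma,\delta}(x)\in\{1,2,\dots\}\cup\{\infty\}$ be the first $(\sigma,\delta)$-hyperbolic time of $x$, with $h(x)=\infty$ if there is none. Statement. 1. $f$ is a continuous local homeomorphism, differentiable exactly at the points other than $0$. The set of points at which $f$ fails to be a $C^2$ local diffeomorphism is exactly $\mathcal S$, and $\mathcal S$ is a non-degenerate exceptional set for $f$ with some constants $B>1$, $\beta>0$. 2. $f$ is topologically mixing; moreover, for every non-empty open $J\subset S^1$ there is $N$ with $f^N(J)=S^1$.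 3. $f$ preserves $m$. 4. For all constants $B,\beta$ for which $\mathcal S$ is a non-degenerate exceptional set for $f$, and every $b$ with $0<b<\min\{1/2,1/(4\beta)\}$: (a) there are $0<\sigma<1$, $\delta>0$ and $\theta>0$ such that for $m$-almost every $x$ the frequency of $(\sigma,\delta)$-hyperbolic times for $x$ is greater than $\theta$; (b) for every $0<\sigma<1$ and every $\delta>0$ the first $(\sigma,\delta)$-hyperbolic time map is not Lebesgue integrable: $\int_{S^1}h_{\sigma,\delta}\,dm=\infty$. -/

import Mathlib

open Set Filter Topology MeasureTheory
open scoped ENNReal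

namespace HyperbolicTimes

instance factTwoPos : Fact ((0 : ℝ) < 2) := ⟨two_pos⟩

/-- The circle `S¹ = [-1, 1] / (-1 ∼ 1)`, realised as `ℝ / 2ℤ`. Its metric is the arc-length
distance of a circle of length `2`. -/
abbrev S1 : Type := AddCircle (2 : ℝ)

/-- Normalised Lebesgue measure on the circle (the Haar probability measure). -/
noncomputable abbrev leb : Measure S1 := AddCircle.haarAddCircle

/-! ### Derivatives of circle maps -/

/-- The expression of `f` in the arc-length charts centred at `x` and `f x`: for a real number `s`,
the representative in `[-1, 1)` of `f (x + s) - f x`. -/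
noncomputable def chartExpr (f : S1 → S1) (x : S1) (s : ℝ) : ℝ :=
  (AddCircle.equivIco 2 (-1) (f (x + (s : S1)) - f x) : ℝ)

/-- The derivative of a circle map at `x` (in the arc-length coordinate). -/
noncomputable def circleDeriv (f : S1 → S1) (x : S1) : ℝ := deriv (chartExpr f x) 0

/-- `f` is a `C²` local diffeomorphism at `x`: it is `C²` near `x` with non-zero derivative
at `x` (by the inverse function theorem). -/
def IsC2LocalDiffeoAt (f : S1 → S1) (x : S1) : Prop :=
  ContDiffAt ℝ 2 (chartExpr f x) 0 ∧ circleDeriv f x ≠ 0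

/-- The norm `‖Df(x)⁻¹‖`, which in dimension one is `1 / |f'(x)|`. -/
noncomputable def invDerivNorm (f : S1 → S1) (x : S1) : ℝ := |circleDeriv f x|⁻¹

/-! ### Exceptional sets and hyperbolic times -/

/-- `S` is a non-degenerate exceptional set for the circle map `f`, with constants `B` and `β`.
A compact submanifold of the circle of dimension `< 1` is a finite set. -/
structure IsNondegenerateExceptionalSet (f : S1 → S1) (S : Set S1) (B β : ℝ) : Prop where
  finite : S.Finite
  one_lt : 1 < B
  pos : 0 < β
  localDiffeo : ∀ x ∉ S, IsC2LocalDiffeoAt f x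
  deriv_lower : ∀ x ∉ S, 1 / B * Metric.infDist x S ^ β ≤ |circleDeriv f x|
  deriv_upper : ∀ x ∉ S, |circleDeriv f x| ≤ B * Metric.infDist x S ^ (-β)
  log_inv_lipschitz : ∀ x ∉ S, ∀ y ∉ S, dist x y < Metric.infDist x S / 2 →
    |Real.log (invDerivNorm f x) - Real.log (invDerivNorm f y)|
      ≤ B / Metric.infDist x S ^ β * dist x y
  log_det_lipschitz : ∀ x ∉ S, ∀ y ∉ S, dist x y < Metric.infDist x S / 2 →
    |Real.log (|circleDeriv f x|) - Real.log (|circleDeriv f y|)|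
      ≤ B / Metric.infDist x S ^ β * dist x y

open Classical in
/-- The `δ`-truncated distance from `x` to `S`. -/
noncomputable def truncDist (δ : ℝ) (x : S1) (S : Set S1) : ℝ :=
  if Metric.infDist x S ≤ δ then Metric.infDist x S else 1

/-- `n` is a `(σ, δ)`-hyperbolic time for `x`, with respect to the map `f`, the exceptional
set `S` and the fixed exponent `b`. -/
def IsHyperbolicTime (f : S1 → S1) (S : Set S1) (b σ δ : ℝ) (n : ℕ) (x : S1) : Prop :=
  ∀ k : ℕ, 1 ≤ k → k ≤ n →
    ∏ j ∈ Finset.Ico (n - k) n, invDerivNorm f (f^[j] x) ≤ σ ^ k ∧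
    σ ^ (b * (k : ℝ)) ≤ truncDist δ (f^[n - k] x) S

/-- The frequency of `(σ, δ)`-hyperbolic times for `x` is greater than `θ`: for all large `n`
there are at least `θ n` hyperbolic times among `1, …, n`. -/
def FrequencyGreaterThan (f : S1 → S1) (S : Set S1) (b σ δ θ : ℝ) (x : S1) : Prop :=
  ∀ᶠ n : ℕ in atTop,
    θ * (n : ℝ) ≤ (({m : ℕ | 1 ≤ m ∧ m ≤ n ∧ IsHyperbolicTime f S b σ δ m x}.ncard : ℕ) : ℝ)

/-- The first `(σ, δ)`-hyperbolic time of `x`: the least positive integer which is a hyperbolic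
time for `x`, and `∞` if there is none. -/
noncomputable def firstHyperbolicTime (f : S1 → S1) (S : Set S1) (b σ δ : ℝ) (x : S1) : ℝ≥0∞ :=
  ⨅ (n : ℕ) (_ : 1 ≤ n ∧ IsHyperbolicTime f S b σ δ n x), (n : ℝ≥0∞)

/-- Topological mixing. -/
def IsTopologicallyMixing (f : S1 → S1) : Prop :=
  ∀ U V : Set S1, IsOpen U → IsOpen V → U.Nonempty → V.Nonempty →
    ∃ N : ℕ, ∀ n ≥ N, (f^[n] '' U ∩ V).Nonempty

/-! ### The map -/

/-- The interval map `x ↦ 2√x - 1` for `x ≥ 0`, `x ↦ 1 - 2√|x|` for `x < 0`. -/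
noncomputable def intervalMap (x : ℝ) : ℝ :=
  if 0 ≤ x then 2 * √x - 1 else 1 - 2 * √|x|

/-- The circle map induced by `intervalMap` on `[-1, 1] / (-1 ∼ 1)`. -/
noncomputable def mannevilleMap : S1 → S1 :=
  AddCircle.liftIco 2 (-1) (fun x : ℝ => (intervalMap x : S1))

/-- The defining property of `mannevilleMap`, on the whole closed interval `[-1, 1]`. -/
theorem mannevilleMap_coe {x : ℝ} (hx : x ∈ Icc (-1 : ℝ) 1) :
    mannevilleMap (x : S1) = (intervalMap x : S1) := by
  rcases eq_or_lt_of_le hx.2 with h | h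
  · have h1 : ((1 : ℝ) : S1) = ((-1 : ℝ) : S1) := by
      have := AddCircle.coe_add_period (2 : ℝ) (-1)
      norm_num at this
      simpa using this
    have e1 : intervalMap 1 = 1 := by norm_num [intervalMap]
    have e2 : intervalMap (-1) = -1 := by norm_num [intervalMap]
    rw [h, e1, h1, mannevilleMap, AddCircle.liftIco_coe_apply (by constructor <;> norm_num), e2]
  · rw [mannevilleMap, AddCircle.liftIco_coe_apply ⟨hx.1, by linarith⟩]

/-- The exceptional set `{0, ±1}`; the points `1` and `-1` of `[-1, 1]` agree on the circle. -/
def excSet : Set S1 := {((0 : ℝ) : S1), ((1 : ℝ) : S1)}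

end HyperbolicTimes

open HyperbolicTimes

/-! The two inverse branches have derivatives `(1 + y) / 2` and `(1 - y) / 2`, which add up to `1`;
this is why Lebesgue measure is invariant. The fixed point `1` is neutral, so uniform expansion is
not available, and ergodicity and mixing are obtained from monotonicity instead. The transfer
operator preserves monotone functions with values in `[0, 1]`. As `x - intervalMap x` has the sign
of `x` and mean zero, each application lowers the first moment `∫ x h` by `∫ |x - intervalMap x| |h
x - h 0|`. The moments are bounded, so these losses tend to zero, and monotonicity turns this into
pointwise convergence of the iterates to the mean of `h` (`tendsto_transfer`). Applied to indicators
of half-lines, this shows that an invariant set has constant density (`volume_invariant_eq_zero`)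
and that the iterates of any interval cover `[-1/2, 1/2]` (`exists_iterate_image_superset`), hence
the circle one step later.

Positive frequency is a Pliss-type count. An orbit visits the region where the derivative is at
least `2` with frequency above `1/8`, so the walk that counts visits minus `1/16` per step has
linearly many records; at a record every final stretch of the orbit contracts backwards. The
logarithm of the distance to `excSet` is integrable, so for small `δ` few records are spoiled by a
close approach. Both frequencies need only a one-sided ergodic theorem (`ae_bddAbove_birkhoffSum`).

Non-integrability comes from the neutral point: the orbit of `1 - t` needs about `1 / t` steps to
leave a fixed neighbourhood of `1`, no hyperbolic time occurs before that, and `1 / t` is not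
integrable. -/

namespace HyperbolicTimes

/-! ### A one-sided ergodic theorem -/

section Birkhoff

variable {α : Type*}

/-- The maximum of the Birkhoff sums of order at most `n`. -/
noncomputable def maxBirkhoffSum (T : α → α) (u : α → ℝ) : ℕ → α → ℝ
  | 0, _ => 0
  | n + 1, x => max 0 (u x + maxBirkhoffSum T u n (T x))

theorem maxBirkhoffSum_nonneg (T : α → α) (u : α → ℝ) (n : ℕ) (x : α) :
    0 ≤ maxBirkhoffSum T u n x := by
  cases n with
  | zero => exact le_rfl
  | succ n => exact le_max_left _ _

theorem maxBirkhoffSum_le_succ (T : α → α) (u : α → ℝ) (n : ℕ) :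
    ∀ x, maxBirkhoffSum T u n x ≤ maxBirkhoffSum T u (n + 1) x := by
  induction n with
  | zero => exact fun x => le_max_left _ _
  | succ n ih => exact fun x => max_le_max le_rfl (by gcongr; exact ih (T x))

theorem birkhoffSum_le_maxBirkhoffSum (T : α → α) (u : α → ℝ) (n : ℕ) :
    ∀ x, birkhoffSum T u n x ≤ maxBirkhoffSum T u n x := by
  induction n with
  | zero => simp [maxBirkhoffSum]
  | succ n ih =>
    intro x
    rw [birkhoffSum_succ']
    exact le_max_of_le_right (by gcongr; exact ih (T x))

theorem bddAbove_birkhoffSum_comp_iff (T : α → α) (u : α → ℝ) (x : α) :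
    BddAbove (range fun n => birkhoffSum T u n (T x)) ↔
      BddAbove (range fun n => birkhoffSum T u n x) := by
  constructor
  · rintro ⟨C, hC⟩
    refine ⟨max 0 (u x + C), ?_⟩
    rintro _ ⟨n, rfl⟩
    cases n with
    | zero => simp
    | succ n =>
      simp only [birkhoffSum_succ']
      exact le_max_of_le_right (by gcongr; exact hC ⟨n, rfl⟩)
  · rintro ⟨C, hC⟩
    refine ⟨C - u x, ?_⟩
    rintro _ ⟨n, rfl⟩
    have := hC ⟨n + 1, rfl⟩
    simp only [birkhoffSum_succ'] at this
    simp only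
    linarith

variable [MeasurableSpace α] {μ : Measure α} {T : α → α} {u : α → ℝ}

theorem measurable_birkhoffSum (hT : Measurable T) (hu : Measurable u) (n : ℕ) :
    Measurable (birkhoffSum T u n) :=
  Finset.measurable_sum _ fun k _ => hu.comp (hT.iterate k)

theorem integrable_maxBirkhoffSum (hT : MeasurePreserving T μ μ) (hu : Integrable u μ) (n : ℕ) :
    Integrable (maxBirkhoffSum T u n) μ := by
  induction n with
  | zero => exact integrable_zero _ _ _
  | succ n ih =>
    exact (integrable_zero _ _ _).sup (hu.add (hT.integrable_comp_of_integrable ih))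

/-- If the mean of `u` is negative, its Birkhoff sums are almost everywhere bounded above. -/
theorem ae_bddAbove_birkhoffSum (hT : Ergodic T μ) (hum : Measurable u)
    (hu : Integrable u μ) (hneg : ∫ x, u x ∂μ < 0) :
    ∀ᵐ x ∂μ, BddAbove (range fun n => birkhoffSum T u n x) := by
  set A : Set α := {x | BddAbove (range fun n => birkhoffSum T u n x)} with hA
  have hAm : MeasurableSet A :=
    measurableSet_bddAbove_range fun n => measurable_birkhoffSum hT.measurable hum n
  have hinv : T ⁻¹' A = A := by
    ext x
    exact bddAbove_birkhoffSum_comp_iff T u x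
  rcases hT.toPreErgodic.ae_mem_or_ae_notMem hAm hinv with h | h
  · exact h
  -- Otherwise the sums are almost everywhere unbounded. The increments `D n` are dominated by `|u|`
  -- in their form as a maximum, have non-negative integral in their form as a difference, and
  -- converge to `u`; so `u` would have non-negative mean.
  exfalso
  have hTinv : ∀ᵐ x ∂μ, T x ∉ A := by
    filter_upwards [h] with x hx
    rwa [← hinv] at hx
  set D : ℕ → α → ℝ := fun n x => max (-maxBirkhoffSum T u n (T x)) (u x) with hD
  have hDeq : ∀ n x, D n x = maxBirkhoffSum T u (n + 1) x - maxBirkhoffSum T u n (T x) := by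
    intro n x
    simp only [hD, maxBirkhoffSum]
    rw [← max_sub_sub_right, zero_sub, add_sub_cancel_right]
  have hlim : ∀ᵐ x ∂μ, Tendsto (fun n => D n x) atTop (𝓝 (u x)) := by
    filter_upwards [hTinv] with x hx
    have : ∃ n, -u x < birkhoffSum T u n (T x) := by
      by_contra! hcon
      exact hx ⟨-u x, by rintro _ ⟨n, rfl⟩; exact hcon n⟩
    obtain ⟨N, hN⟩ := this
    refine tendsto_const_nhds.congr' ?_
    filter_upwards [eventually_ge_atTop N] with n hn
    have hmono : Monotone fun n => maxBirkhoffSum T u n (T x) :=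
      monotone_nat_of_le_succ fun n => maxBirkhoffSum_le_succ T u n (T x)
    have h1 := hmono hn
    have h2 := birkhoffSum_le_maxBirkhoffSum T u N (T x)
    simp only at h1
    exact (max_eq_right (by linarith)).symm
  have hint : ∀ n, 0 ≤ ∫ x, D n x ∂μ := by
    intro n
    have h1 := integrable_maxBirkhoffSum hT.toMeasurePreserving hu (n + 1)
    have h0 := integrable_maxBirkhoffSum hT.toMeasurePreserving hu n
    have h2 := hT.toMeasurePreserving.integrable_comp_of_integrable h0
    have h3 : ∫ x, maxBirkhoffSum T u n (T x) ∂μ = ∫ x, maxBirkhoffSum T u n x ∂μ := by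
      have hm : AEStronglyMeasurable (maxBirkhoffSum T u n) (μ.map T) := by
        rw [hT.map_eq]; exact h0.1
      rw [← integral_map hT.measurable.aemeasurable hm, hT.map_eq]
    simp_rw [hDeq]
    have h4 := integral_sub h1 h2
    simp only [Function.comp_apply] at h4
    rw [h4, h3, sub_nonneg]
    exact integral_mono h0 h1 (maxBirkhoffSum_le_succ T u n)
  have hconv : Tendsto (fun n => ∫ x, D n x ∂μ) atTop (𝓝 (∫ x, u x ∂μ)) := by
    refine tendsto_integral_of_dominated_convergence (fun x => |u x|) (fun n => ?_) hu.abs ?_ hlim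
    · have h1 := integrable_maxBirkhoffSum hT.toMeasurePreserving hu (n + 1)
      have h2 := hT.toMeasurePreserving.integrable_comp_of_integrable
        (integrable_maxBirkhoffSum hT.toMeasurePreserving hu n)
      exact ((h1.sub h2).congr (ae_of_all _ fun x => (hDeq n x).symm)).1
    · refine fun n => ae_of_all _ fun x => ?_
      rw [Real.norm_eq_abs, abs_le]
      refine ⟨(neg_abs_le _).trans (le_max_right _ _), max_le ?_ (le_abs_self _)⟩
      have := maxBirkhoffSum_nonneg T u n (T x)
      have := abs_nonneg (u x)
      linarith
  exact absurd (ge_of_tendsto' hconv hint) (not_le.mpr hneg)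

end Birkhoff

/-! ### Counting good times -/

section Pliss

open Classical in
/-- A walk from `0` climbing at most `1` per step has at least `S m` weak records up to any time
`N ≥ m`. -/
theorem le_card_records {S : ℕ → ℝ} (h0 : S 0 ≤ 0) (hS : ∀ n, S (n + 1) ≤ S n + 1) (N : ℕ) :
    ∀ m ≤ N, S m ≤ (((Finset.Icc 1 N).filter fun n => ∀ j < n, S j ≤ S n).card : ℝ) := by
  induction N with
  | zero =>
    intro m hm
    obtain rfl : m = 0 := by omega
    simpa using h0
  | succ N ih =>
    have hIcc : Finset.Icc 1 (N + 1) = insert (N + 1) (Finset.Icc 1 N) :=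
      (Finset.insert_Icc_right_eq_Icc_add_one (by omega)).symm
    have hnot : N + 1 ∉ (Finset.Icc 1 N).filter fun n => ∀ j < n, S j ≤ S n := by simp
    rw [hIcc, Finset.filter_insert]
    intro m hm
    -- A new record raises the count by one and the height by at most one. Without a record, the
    -- height at `N + 1` is exceeded by an earlier one, already counted.
    by_cases hrec : ∀ j < N + 1, S j ≤ S (N + 1)
    · rw [if_pos hrec, Finset.card_insert_of_notMem hnot]
      push_cast
      have h1 : S m ≤ S (N + 1) := by
        rcases hm.lt_or_eq with h | rfl
        · exact hrec m h
        · exact le_rfl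
      linarith [hS N, ih N le_rfl]
    · rw [if_neg hrec]
      rcases hm.lt_or_eq with h | rfl
      · exact ih m (by omega)
      · push Not at hrec
        obtain ⟨j, hj, hlt⟩ := hrec
        exact hlt.le.trans (ih j (by omega))

open Classical in
/-- The number of times `n ≤ N` lying within distance `r j` after some `j < n` is at most the sum
of the `r j`. -/
theorem card_shadowed_le {r : ℕ → ℝ} (hr : ∀ j, 0 ≤ r j) (N : ℕ) :
    (((Finset.Icc 1 N).filter fun n => ∃ j < n, ((n - j : ℕ) : ℝ) < r j).card : ℝ)
      ≤ ∑ j ∈ Finset.range N, r j := by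
  have hsub : ((Finset.Icc 1 N).filter fun n => ∃ j < n, ((n - j : ℕ) : ℝ) < r j) ⊆
      (Finset.range N).biUnion fun j => Finset.Ioc j (j + ⌊r j⌋₊) := by
    intro n hn
    simp only [Finset.mem_filter, Finset.mem_Icc, Finset.mem_biUnion, Finset.mem_range,
      Finset.mem_Ioc] at hn ⊢
    obtain ⟨⟨-, h2⟩, j, hj, hlt⟩ := hn
    have := Nat.le_floor hlt.le
    exact ⟨j, by omega, hj, by omega⟩
  calc _ ≤ (((Finset.range N).biUnion fun j => Finset.Ioc j (j + ⌊r j⌋₊)).card : ℝ) := by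
        exact_mod_cast Finset.card_le_card hsub
    _ ≤ ((∑ j ∈ Finset.range N, (Finset.Ioc j (j + ⌊r j⌋₊)).card : ℕ) : ℝ) := by
        exact_mod_cast Finset.card_biUnion_le
    _ ≤ ∑ j ∈ Finset.range N, r j := by
        push_cast
        refine Finset.sum_le_sum fun j _ => ?_
        simpa using Nat.floor_le (hr j)

end Pliss

/-! ### The transfer operator of the interval map -/

theorem intervalMap_of_nonneg {x : ℝ} (hx : 0 ≤ x) : intervalMap x = 2 * √x - 1 := if_pos hx

theorem intervalMap_of_neg {x : ℝ} (hx : x < 0) : intervalMap x = 1 - 2 * √(-x) := by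
  rw [intervalMap, if_neg (not_le.mpr hx), abs_of_neg hx]

theorem measurable_intervalMap : Measurable intervalMap := by
  unfold intervalMap
  exact Measurable.ite measurableSet_Ici (by fun_prop) (by fun_prop)

theorem intervalMap_mem_Icc {x : ℝ} (hx : x ∈ Icc (-1 : ℝ) 1) : intervalMap x ∈ Icc (-1 : ℝ) 1 := by
  rcases le_or_gt 0 x with h | h
  · rw [intervalMap_of_nonneg h]
    have h1 := Real.sqrt_nonneg x
    have h2 := Real.sqrt_le_one.mpr hx.2
    constructor <;> linarith
  · rw [intervalMap_of_neg h]
    have h1 := Real.sqrt_nonneg (-x)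
    have h2 : √(-x) ≤ 1 := Real.sqrt_le_one.mpr (by linarith [hx.1])
    constructor <;> linarith

theorem intervalMap_posBranch {y : ℝ} (hy : -1 ≤ y) : intervalMap (((1 + y) / 2) ^ 2) = y := by
  rw [intervalMap_of_nonneg (sq_nonneg _), Real.sqrt_sq (by linarith)]
  ring

/-- The endpoint `y = 1` is excluded because its branch point is `0`, which `intervalMap` sends to
`-1`. -/
theorem intervalMap_negBranch {y : ℝ} (hy : y < 1) : intervalMap (-((1 - y) / 2) ^ 2) = y := by
  have h : 0 < ((1 - y) / 2) ^ 2 := by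
    have : 0 < (1 - y) / 2 := by linarith
    positivity
  rw [intervalMap_of_neg (by linarith), neg_neg, Real.sqrt_sq (by linarith)]
  ring

theorem posBranch_mem {y : ℝ} (hy : y ∈ Icc (-1 : ℝ) 1) : ((1 + y) / 2) ^ 2 ∈ Icc (0 : ℝ) 1 :=
  ⟨sq_nonneg _, by nlinarith [hy.1, hy.2]⟩

theorem negBranch_mem {y : ℝ} (hy : y ∈ Icc (-1 : ℝ) 1) : -((1 - y) / 2) ^ 2 ∈ Icc (-1 : ℝ) 0 :=
  ⟨by nlinarith [hy.1, hy.2], by nlinarith [sq_nonneg ((1 - y) / 2)]⟩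

/-- The transfer operator of `intervalMap` with respect to Lebesgue measure on `[-1, 1]`. -/
noncomputable def transfer (h : ℝ → ℝ) (y : ℝ) : ℝ :=
  (1 + y) / 2 * h (((1 + y) / 2) ^ 2) + (1 - y) / 2 * h (-((1 - y) / 2) ^ 2)

theorem integrableOn_Icc_of_bounded {F : ℝ → ℝ} (hF : Measurable F) {C : ℝ}
    (hC : ∀ x ∈ Icc (-1 : ℝ) 1, |F x| ≤ C) : IntegrableOn F (Icc (-1) 1) :=
  Measure.integrableOn_of_bounded (M := C) (by simp) hF.aestronglyMeasurable
    ((ae_restrict_iff' measurableSet_Icc).mpr (ae_of_all _ hC))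

theorem image_posBranch : (fun y : ℝ => ((1 + y) / 2) ^ 2) '' Icc (-1) 1 = Icc 0 1 := by
  ext x
  constructor
  · rintro ⟨y, hy, rfl⟩
    exact posBranch_mem hy
  · rintro hx
    refine ⟨2 * √x - 1, ?_, ?_⟩
    · have h1 := Real.sqrt_nonneg x
      have h2 := Real.sqrt_le_one.mpr hx.2
      constructor <;> linarith
    · have h1 := Real.sq_sqrt hx.1
      simp only
      linear_combination h1

theorem image_negBranch : (fun y : ℝ => -((1 - y) / 2) ^ 2) '' Ico (-1) 1 = Ico (-1) 0 := by
  ext x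
  constructor
  · rintro ⟨y, hy, rfl⟩
    have h : 0 < (1 - y) / 2 := by linarith [hy.2]
    exact ⟨by nlinarith [hy.1, hy.2], neg_neg_of_pos (by positivity)⟩
  · rintro hx
    refine ⟨1 - 2 * √(-x), ?_, ?_⟩
    · have h1 : 0 < √(-x) := Real.sqrt_pos.mpr (by linarith [hx.2])
      have h2 : √(-x) ≤ 1 := Real.sqrt_le_one.mpr (by linarith [hx.1])
      constructor <;> linarith
    · have h1 := Real.sq_sqrt (show 0 ≤ -x by linarith [hx.2])
      simp only
      linear_combination -h1

theorem injOn_posBranch : InjOn (fun y : ℝ => ((1 + y) / 2) ^ 2) (Icc (-1) 1) := by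
  intro a ha b hb hab
  have := congrArg intervalMap hab
  simpa only [intervalMap_posBranch ha.1, intervalMap_posBranch hb.1] using this

theorem injOn_negBranch : InjOn (fun y : ℝ => -((1 - y) / 2) ^ 2) (Ico (-1) 1) := by
  intro a ha b hb hab
  have := congrArg intervalMap hab
  simpa only [intervalMap_negBranch ha.2, intervalMap_negBranch hb.2] using this

theorem setIntegral_posBranch (F : ℝ → ℝ) :
    ∫ x in Icc (0 : ℝ) 1, F x =
      ∫ y in Icc (-1 : ℝ) 1, (1 + y) / 2 * F (((1 + y) / 2) ^ 2) := by
  rw [← image_posBranch, integral_image_eq_integral_abs_deriv_smul (f' := fun y => (1 + y) / 2)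
    measurableSet_Icc (fun y _ => ?_) injOn_posBranch]
  · refine setIntegral_congr_fun measurableSet_Icc fun y hy => ?_
    simp only [smul_eq_mul]
    rw [abs_of_nonneg (by linarith [hy.1])]
  · have : HasDerivAt (fun y : ℝ => ((1 + y) / 2) ^ 2) (2 * ((1 + y) / 2) ^ 1 * (1 / 2)) y := by
      simpa using (((hasDerivAt_id y).const_add 1).div_const 2).fun_pow 2
    exact (this.congr_deriv (by ring)).hasDerivWithinAt

theorem setIntegral_negBranch (F : ℝ → ℝ) :
    ∫ x in Ico (-1 : ℝ) 0, F x =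
      ∫ y in Ico (-1 : ℝ) 1, (1 - y) / 2 * F (-((1 - y) / 2) ^ 2) := by
  rw [← image_negBranch, integral_image_eq_integral_abs_deriv_smul (f' := fun y => (1 - y) / 2)
    measurableSet_Ico (fun y _ => ?_) injOn_negBranch]
  · refine setIntegral_congr_fun measurableSet_Ico fun y hy => ?_
    simp only [smul_eq_mul]
    rw [abs_of_nonneg (by linarith [hy.2])]
  · have : HasDerivAt (fun y : ℝ => -((1 - y) / 2) ^ 2) (-(2 * ((1 - y) / 2) ^ 1 * (-1 / 2))) y := by
      simpa using ((((hasDerivAt_id y).const_sub 1).div_const 2).fun_pow 2).fun_neg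
    exact (this.congr_deriv (by ring)).hasDerivWithinAt

theorem measurable_transfer {h : ℝ → ℝ} (hh : Measurable h) : Measurable (transfer h) := by
  unfold transfer
  fun_prop

/-- Duality between composition and transfer, by the change of variables along each inverse branch.
The bounds on `φ` and `h` serve integrability only. -/
theorem setIntegral_comp_intervalMap_mul {φ h : ℝ → ℝ} (hφ : Measurable φ) (hh : Measurable h)
    {C : ℝ} (hC : ∀ x ∈ Icc (-1 : ℝ) 1, |φ x| ≤ C) (hb : ∀ x ∈ Icc (-1 : ℝ) 1, |h x| ≤ 1) :
    ∫ x in Icc (-1 : ℝ) 1, φ (intervalMap x) * h x =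
      ∫ y in Icc (-1 : ℝ) 1, φ y * transfer h y := by
  have hC0 : 0 ≤ C := (abs_nonneg _).trans (hC 0 (by norm_num))
  have hint : IntegrableOn (fun x => φ (intervalMap x) * h x) (Icc (-1) 1) := by
    refine integrableOn_Icc_of_bounded (C := C * 1)
      ((hφ.comp measurable_intervalMap).mul hh) fun x hx => ?_
    rw [abs_mul]
    exact mul_le_mul (hC _ (intervalMap_mem_Icc hx)) (hb x hx) (abs_nonneg _) hC0
  have hbound : ∀ a b c : ℝ, 0 ≤ a → a ≤ 1 → |b| ≤ C → |c| ≤ 1 → |a * (b * c)| ≤ C := by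
    intro a b c ha ha1 hb hc
    rw [abs_mul, abs_mul, abs_of_nonneg ha]
    calc a * (|b| * |c|) ≤ 1 * (C * 1) := by gcongr
      _ = C := by ring
  have hint1 : IntegrableOn (fun y => (1 + y) / 2 * (φ y * h (((1 + y) / 2) ^ 2))) (Icc (-1) 1) := by
    refine integrableOn_Icc_of_bounded (C := C) (by fun_prop) fun y hy => ?_
    have := posBranch_mem hy
    exact hbound _ _ _ (by linarith [hy.1]) (by linarith [hy.2]) (hC y hy)
      (hb _ ⟨by linarith [this.1], this.2⟩)
  have hint2 : IntegrableOn (fun y => (1 - y) / 2 * (φ y * h (-((1 - y) / 2) ^ 2))) (Icc (-1) 1) := by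
    refine integrableOn_Icc_of_bounded (C := C) (by fun_prop) fun y hy => ?_
    have := negBranch_mem hy
    exact hbound _ _ _ (by linarith [hy.2]) (by linarith [hy.1]) (hC y hy)
      (hb _ ⟨this.1, by linarith [this.2]⟩)
  have hunion : Icc (-1 : ℝ) 1 = Ico (-1) 0 ∪ Icc 0 1 :=
    (Ico_union_Icc_eq_Icc (by norm_num) (by norm_num)).symm
  have hdisj : Disjoint (Ico (-1 : ℝ) 0) (Icc 0 1) :=
    disjoint_left.mpr fun x hx hx' => not_lt.mpr hx'.1 hx.2
  have hsplit : ∫ x in Icc (-1 : ℝ) 1, φ (intervalMap x) * h x =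
      (∫ x in Ico (-1 : ℝ) 0, φ (intervalMap x) * h x) +
        ∫ x in Icc (0 : ℝ) 1, φ (intervalMap x) * h x := by
    rw [hunion] at hint ⊢
    exact setIntegral_union hdisj measurableSet_Icc hint.left_of_union hint.right_of_union
  rw [hsplit, setIntegral_posBranch, setIntegral_negBranch]
  have e1 : ∫ y in Icc (-1 : ℝ) 1, (1 + y) / 2 *
      (φ (intervalMap (((1 + y) / 2) ^ 2)) * h (((1 + y) / 2) ^ 2)) =
      ∫ y in Icc (-1 : ℝ) 1, (1 + y) / 2 * (φ y * h (((1 + y) / 2) ^ 2)) :=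
    setIntegral_congr_fun measurableSet_Icc fun y hy => by
      simp only [intervalMap_posBranch hy.1]
  have e2 : ∫ y in Ico (-1 : ℝ) 1, (1 - y) / 2 *
      (φ (intervalMap (-((1 - y) / 2) ^ 2)) * h (-((1 - y) / 2) ^ 2)) =
      ∫ y in Icc (-1 : ℝ) 1, (1 - y) / 2 * (φ y * h (-((1 - y) / 2) ^ 2)) := by
    rw [integral_Icc_eq_integral_Ico]
    exact setIntegral_congr_fun measurableSet_Ico fun y hy => by
      simp only [intervalMap_negBranch hy.2]
  rw [e1, e2, add_comm, ← integral_add hint1 hint2]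
  refine setIntegral_congr_fun measurableSet_Icc fun y _ => ?_
  simp only [transfer]
  ring

/-- Measurable monotone functions from `[-1, 1]` to `[0, 1]`. -/
structure IsMonotoneObservable (h : ℝ → ℝ) : Prop where
  measurable : Measurable h
  nonneg : ∀ x ∈ Icc (-1 : ℝ) 1, 0 ≤ h x
  le_one : ∀ x ∈ Icc (-1 : ℝ) 1, h x ≤ 1
  mono : MonotoneOn h (Icc (-1) 1)

namespace IsMonotoneObservable

variable {h : ℝ → ℝ}

theorem abs_le_one (hh : IsMonotoneObservable h) (x : ℝ) (hx : x ∈ Icc (-1 : ℝ) 1) : |h x| ≤ 1 := by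
  rw [abs_of_nonneg (hh.nonneg x hx)]
  exact hh.le_one x hx

theorem abs_sub_le_one (hh : IsMonotoneObservable h) {x y : ℝ} (hx : x ∈ Icc (-1 : ℝ) 1)
    (hy : y ∈ Icc (-1 : ℝ) 1) : |h x - h y| ≤ 1 :=
  abs_sub_le_iff.mpr ⟨by linarith [hh.le_one x hx, hh.nonneg y hy],
    by linarith [hh.le_one y hy, hh.nonneg x hx]⟩

/-- The weights are non-negative with sum `1`, which preserves the bounds. Both branches increase
with `y`, and the weight moves towards the positive branch, where `h` is larger. -/
theorem transfer (hh : IsMonotoneObservable h) : IsMonotoneObservable (transfer h) := by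
  have hp : ∀ {y : ℝ}, y ∈ Icc (-1 : ℝ) 1 → ((1 + y) / 2) ^ 2 ∈ Icc (-1 : ℝ) 1 := fun hy =>
    ⟨by linarith [(posBranch_mem hy).1], (posBranch_mem hy).2⟩
  have hn : ∀ {y : ℝ}, y ∈ Icc (-1 : ℝ) 1 → -((1 - y) / 2) ^ 2 ∈ Icc (-1 : ℝ) 1 := fun hy =>
    ⟨(negBranch_mem hy).1, by linarith [(negBranch_mem hy).2]⟩
  refine ⟨measurable_transfer hh.measurable, fun y hy => ?_, fun y hy => ?_, ?_⟩
  · have h1 := hh.nonneg _ (hp hy)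
    have h2 := hh.nonneg _ (hn hy)
    have : 0 ≤ 1 + y := by linarith [hy.1]
    have : 0 ≤ 1 - y := by linarith [hy.2]
    unfold HyperbolicTimes.transfer
    positivity
  · have h1 := hh.le_one _ (hp hy)
    have h2 := hh.le_one _ (hn hy)
    unfold HyperbolicTimes.transfer
    nlinarith [hy.1, hy.2]
  · intro y hy z hz hyz
    have h1 := hh.mono (hp hy) (hp hz) (by nlinarith [hy.1])
    have h2 := hh.mono (hn hy) (hn hz) (by nlinarith [hz.2])
    have h3 := hh.mono (hn hz) (hp hz) (by linarith [(posBranch_mem hz).1, (negBranch_mem hz).2])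
    unfold HyperbolicTimes.transfer
    -- The branch points move from `y` to `z` first, with the weights frozen at `y`; then the
    -- weights move.
    calc _ ≤ (1 + y) / 2 * h (((1 + z) / 2) ^ 2) + (1 - y) / 2 * h (-((1 - z) / 2) ^ 2) := by
          have : 0 ≤ 1 + y := by linarith [hy.1]
          have : 0 ≤ 1 - y := by linarith [hy.2]
          gcongr
      _ ≤ _ := by nlinarith

theorem iterate (hh : IsMonotoneObservable h) (n : ℕ) :
    IsMonotoneObservable (HyperbolicTimes.transfer^[n] h) := by
  induction n with
  | zero => exact hh
  | succ n ih =>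
    rw [Function.iterate_succ_apply']
    exact ih.transfer

end IsMonotoneObservable

/-! ### Loss of the first moment and convergence to the mean -/

theorem self_sub_intervalMap_nonneg {x : ℝ} (hx : 0 ≤ x) : 0 ≤ x - intervalMap x := by
  rw [intervalMap_of_nonneg hx]
  -- The difference is the square `(1 - √x) ^ 2`.
  nlinarith [Real.sq_sqrt hx, sq_nonneg (1 - √x)]

theorem self_sub_intervalMap_nonpos {x : ℝ} (hx : x < 0) : x - intervalMap x ≤ 0 := by
  rw [intervalMap_of_neg hx]
  nlinarith [Real.sq_sqrt (show 0 ≤ -x by linarith), sq_nonneg (1 - √(-x))]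

theorem self_sub_intervalMap_ne_zero {x : ℝ} (hx : x ∈ Ioo (-1 : ℝ) 1) :
    x - intervalMap x ≠ 0 := by
  rcases le_or_gt 0 x with h | h
  · rw [intervalMap_of_nonneg h]
    have h1 : √x < 1 := (Real.sqrt_lt' one_pos).mpr (by linarith [hx.2])
    nlinarith [Real.sq_sqrt h, sq_pos_of_pos (sub_pos.mpr h1)]
  · rw [intervalMap_of_neg h]
    have h1 : √(-x) < 1 := (Real.sqrt_lt' one_pos).mpr (by linarith [hx.1])
    nlinarith [Real.sq_sqrt (show 0 ≤ -x by linarith), sq_pos_of_pos (sub_pos.mpr h1)]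

theorem setIntegral_self_sub_intervalMap : ∫ x in Icc (-1 : ℝ) 1, (x - intervalMap x) = 0 := by
  have h := setIntegral_comp_intervalMap_mul (φ := id) (h := fun _ => 1) measurable_id
    measurable_const (C := 1) (fun x hx => abs_le.mpr hx) (by simp)
  have ht : HyperbolicTimes.transfer (fun _ => 1) = fun _ => 1 := by
    funext y
    simp only [transfer]
    ring
  rw [ht] at h
  simp only [id, mul_one] at h
  rw [integral_sub, h, sub_self]
  · exact integrableOn_Icc_of_bounded (C := 1) measurable_id fun x hx => abs_le.mpr hx
  · exact integrableOn_Icc_of_bounded (C := 1) measurable_intervalMap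
      fun x hx => abs_le.mpr (intervalMap_mem_Icc hx)

/-- The first moment decreases under the transfer operator, by an explicit amount. -/
theorem moment_sub_moment_transfer {h : ℝ → ℝ} (hh : IsMonotoneObservable h) :
    (∫ x in Icc (-1 : ℝ) 1, x * h x) - ∫ x in Icc (-1 : ℝ) 1, x * transfer h x =
      ∫ x in Icc (-1 : ℝ) 1, |x - intervalMap x| * |h x - h 0| := by
  have hd := setIntegral_comp_intervalMap_mul (φ := id) measurable_id hh.measurable (C := 1)
    (fun x hx => abs_le.mpr hx) hh.abs_le_one
  simp only [id] at hd
  have hm := hh.measurable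
  have hg := measurable_intervalMap
  have h0 : (0 : ℝ) ∈ Icc (-1 : ℝ) 1 := by norm_num
  have hi1 : IntegrableOn (fun x => x * h x) (Icc (-1) 1) := by
    refine integrableOn_Icc_of_bounded (C := 1 * 1) (by fun_prop) fun x hx => ?_
    rw [abs_mul]
    exact mul_le_mul (abs_le.mpr hx) (hh.abs_le_one x hx) (abs_nonneg _) zero_le_one
  have hi2 : IntegrableOn (fun x => intervalMap x * h x) (Icc (-1) 1) := by
    refine integrableOn_Icc_of_bounded (C := 1 * 1) (by fun_prop) fun x hx => ?_
    rw [abs_mul]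
    exact mul_le_mul (abs_le.mpr (intervalMap_mem_Icc hx)) (hh.abs_le_one x hx) (abs_nonneg _)
      zero_le_one
  have hi3 : IntegrableOn (fun x => (x - intervalMap x) * h 0) (Icc (-1) 1) := by
    have : IntegrableOn (fun x => x - intervalMap x) (Icc (-1) 1) :=
      integrableOn_Icc_of_bounded (C := 2) (by fun_prop) fun x hx => by
        have := intervalMap_mem_Icc hx
        exact abs_le.mpr ⟨by linarith [hx.1, this.2], by linarith [hx.2, this.1]⟩
    exact this.mul_const _
  -- The factor `x - intervalMap x` has mean zero, so `h` may be recentred at `h 0`; by monotonicity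
  -- both factors then have the sign of `x`.
  have h4 : ∫ x in Icc (-1 : ℝ) 1, (x - intervalMap x) * h 0 = 0 := by
    rw [integral_mul_const, setIntegral_self_sub_intervalMap, zero_mul]
  have h5 : (∫ x in Icc (-1 : ℝ) 1, x * h x) - (∫ x in Icc (-1 : ℝ) 1, intervalMap x * h x) =
      ∫ x in Icc (-1 : ℝ) 1, (x * h x - intervalMap x * h x - (x - intervalMap x) * h 0) := by
    refine Eq.trans ?_ (integral_sub (hi1.sub hi2) hi3).symm
    rw [h4, sub_zero]
    exact (integral_sub hi1 hi2).symm
  rw [← hd, h5]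
  refine setIntegral_congr_fun measurableSet_Icc fun x hx => ?_
  have e : x * h x - intervalMap x * h x - (x - intervalMap x) * h 0 =
      (x - intervalMap x) * (h x - h 0) := by ring
  rw [e, ← abs_mul, eq_comm, abs_eq_self]
  rcases le_or_gt 0 x with hx0 | hx0
  · exact mul_nonneg (self_sub_intervalMap_nonneg hx0) (sub_nonneg.mpr (hh.mono h0 hx hx0))
  · exact mul_nonneg_of_nonpos_of_nonpos (self_sub_intervalMap_nonpos hx0)
      (sub_nonpos.mpr (hh.mono hx h0 hx0.le))

/-- The defects are the successive decrements of a decreasing sequence of moments that is bounded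
below. -/
theorem tendsto_moment_defect {h : ℝ → ℝ} (hh : IsMonotoneObservable h) :
    Tendsto (fun n => ∫ x in Icc (-1 : ℝ) 1,
      |x - intervalMap x| * |transfer^[n] h x - transfer^[n] h 0|) atTop (𝓝 0) := by
  set F : ℕ → ℝ := fun n => ∫ x in Icc (-1 : ℝ) 1, x * transfer^[n] h x with hF
  have hsucc : ∀ n, F n - F (n + 1) = ∫ x in Icc (-1 : ℝ) 1,
      |x - intervalMap x| * |transfer^[n] h x - transfer^[n] h 0| := by
    intro n
    simp only [hF, Function.iterate_succ_apply']
    exact moment_sub_moment_transfer (hh.iterate n)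
  have hanti : Antitone F := antitone_nat_of_succ_le fun n => by
    rw [← sub_nonneg, hsucc]
    exact integral_nonneg fun x => by positivity
  have hbdd : BddBelow (range F) := by
    refine ⟨-(1 * volume.real (Icc (-1 : ℝ) 1)), ?_⟩
    rintro _ ⟨n, rfl⟩
    suffices hb : ‖F n‖ ≤ 1 * volume.real (Icc (-1 : ℝ) 1) from (abs_le.mp hb).1
    refine norm_setIntegral_le_of_norm_le_const measure_Icc_lt_top fun x hx => ?_
    rw [norm_mul, ← one_mul (1 : ℝ)]
    exact mul_le_mul (abs_le.mpr hx) ((hh.iterate n).abs_le_one x hx) (norm_nonneg _) zero_le_one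
  have hlim := tendsto_atTop_ciInf hanti hbdd
  have := hlim.sub (hlim.comp (tendsto_add_atTop_nat 1))
  rw [sub_self] at this
  refine this.congr fun n => ?_
  exact hsucc n

/-- Iterates of a monotone observable under the transfer operator become locally constant. -/
theorem tendsto_transfer_sub {h : ℝ → ℝ} (hh : IsMonotoneObservable h) {y : ℝ}
    (hy : y ∈ Ioo (-1 : ℝ) 1) :
    Tendsto (fun n => transfer^[n] h y - transfer^[n] h 0) atTop (𝓝 0) := by
  have h0 : (0 : ℝ) ∈ Icc (-1 : ℝ) 1 := by norm_num
  have hyI : y ∈ Icc (-1 : ℝ) 1 := ⟨hy.1.le, hy.2.le⟩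
  have hg := measurable_intervalMap
  -- The interval is the part of `[-1, 1]` beyond `y` as seen from `0`. By monotonicity the
  -- deviation from the value at `0` is at least as large there as at `y`, so the defect bounds it
  -- up to the positive constant `∫ |x - intervalMap x|` over this interval.
  obtain ⟨a, b, hab, hsub, hK⟩ : ∃ a b : ℝ, a < b ∧ Icc a b ⊆ Icc (-1) 1 ∧
      ∀ n, ∀ x ∈ Icc a b,
        |transfer^[n] h y - transfer^[n] h 0| ≤ |transfer^[n] h x - transfer^[n] h 0| := by
    rcases le_or_gt 0 y with hy0 | hy0
    · refine ⟨y, 1, hy.2, Icc_subset_Icc hy.1.le le_rfl, fun n x hx => ?_⟩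
      have hxI : x ∈ Icc (-1 : ℝ) 1 := ⟨hy.1.le.trans hx.1, hx.2⟩
      have h1 := (hh.iterate n).mono h0 hyI hy0
      have h2 := (hh.iterate n).mono hyI hxI hx.1
      rw [abs_of_nonneg (by linarith), abs_of_nonneg (by linarith)]
      linarith
    · refine ⟨-1, y, hy.1, Icc_subset_Icc le_rfl hy.2.le, fun n x hx => ?_⟩
      have hxI : x ∈ Icc (-1 : ℝ) 1 := ⟨hx.1, hx.2.trans hy.2.le⟩
      have h1 := (hh.iterate n).mono hyI h0 hy0.le
      have h2 := (hh.iterate n).mono hxI hyI hx.2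
      rw [abs_of_nonpos (by linarith), abs_of_nonpos (by linarith)]
      linarith
  have hw : IntegrableOn (fun x => |x - intervalMap x|) (Icc (-1) 1) :=
    integrableOn_Icc_of_bounded (C := 2) (by fun_prop) fun x hx => by
      have := intervalMap_mem_Icc hx
      rw [abs_abs]
      exact abs_le.mpr ⟨by linarith [hx.1, this.2], by linarith [hx.2, this.1]⟩
  have hκ : 0 < ∫ x in Icc a b, |x - intervalMap x| := by
    rw [integral_Icc_eq_integral_Ioc, ← intervalIntegral.integral_of_le hab.le]
    refine intervalIntegral.intervalIntegral_pos_of_pos_on ?_ (fun x hx => ?_) hab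
    · rw [intervalIntegrable_iff_integrableOn_Ioc_of_le hab.le]
      exact hw.mono_set (Ioc_subset_Icc_self.trans hsub)
    · have ha := hsub (left_mem_Icc.mpr hab.le)
      have hb := hsub (right_mem_Icc.mpr hab.le)
      exact abs_pos.mpr (self_sub_intervalMap_ne_zero ⟨ha.1.trans_lt hx.1, hx.2.trans_le hb.2⟩)
  have hlim := (tendsto_moment_defect hh).div_const (∫ x in Icc a b, |x - intervalMap x|)
  rw [zero_div] at hlim
  refine squeeze_zero_norm (fun n => ?_) hlim
  rw [le_div_iff₀ hκ, Real.norm_eq_abs, ← integral_const_mul]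
  have hm := (hh.iterate n).measurable
  have hint : IntegrableOn (fun x => |x - intervalMap x| *
      |transfer^[n] h x - transfer^[n] h 0|) (Icc (-1) 1) := by
    refine integrableOn_Icc_of_bounded (C := 2 * 1) (by fun_prop) fun x hx => ?_
    have := intervalMap_mem_Icc hx
    rw [abs_mul, abs_abs, abs_abs]
    exact mul_le_mul (abs_le.mpr ⟨by linarith [hx.1, this.2], by linarith [hx.2, this.1]⟩)
      ((hh.iterate n).abs_sub_le_one hx h0) (abs_nonneg _) zero_le_two
  calc _ ≤ ∫ x in Icc a b, |x - intervalMap x| * |transfer^[n] h x - transfer^[n] h 0| := by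
        refine setIntegral_mono_on ((hw.mono_set hsub).const_mul _) (hint.mono_set hsub)
          measurableSet_Icc fun x hx => ?_
        rw [mul_comm]
        exact mul_le_mul_of_nonneg_left (hK n x hx) (abs_nonneg _)
    _ ≤ _ := setIntegral_mono_set hint (ae_of_all _ fun x => by positivity)
        (LE.le.eventuallyLE hsub)

/-- Correlations of a monotone observable with a bounded function become trivial. -/
theorem tendsto_setIntegral_mul_transfer {h a : ℝ → ℝ} (hh : IsMonotoneObservable h)
    (ha : Measurable a) (hab : ∀ x ∈ Icc (-1 : ℝ) 1, |a x| ≤ 1) :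
    Tendsto (fun n => (∫ x in Icc (-1 : ℝ) 1, a x * transfer^[n] h x) -
      transfer^[n] h 0 * ∫ x in Icc (-1 : ℝ) 1, a x) atTop (𝓝 0) := by
  have h0 : (0 : ℝ) ∈ Icc (-1 : ℝ) 1 := by norm_num
  have hia : IntegrableOn a (Icc (-1) 1) := integrableOn_Icc_of_bounded ha hab
  have heq : ∀ n, (∫ x in Icc (-1 : ℝ) 1, a x * transfer^[n] h x) -
      transfer^[n] h 0 * ∫ x in Icc (-1 : ℝ) 1, a x =
      ∫ x in Icc (-1 : ℝ) 1, a x * (transfer^[n] h x - transfer^[n] h 0) := by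
    intro n
    have hm := (hh.iterate n).measurable
    rw [mul_comm, ← integral_mul_const, ← integral_sub]
    · exact integral_congr_ae (ae_of_all _ fun x => by ring)
    · refine integrableOn_Icc_of_bounded (C := 1 * 1) (by fun_prop) fun x hx => ?_
      rw [abs_mul]
      exact mul_le_mul (hab x hx) ((hh.iterate n).abs_le_one x hx) (abs_nonneg _) zero_le_one
    · exact hia.mul_const _
  simp_rw [heq]
  have hzero : ∫ _x in Icc (-1 : ℝ) 1, (0 : ℝ) = 0 := by simp
  refine Eq.subst (motive := fun l => Tendsto _ _ (𝓝 l)) hzero (tendsto_integral_of_dominated_convergence (f := fun _ => 0) (fun _ => 1) (fun n => ?_)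
    (by simp) (fun n => ?_) ?_)
  · have hm := (hh.iterate n).measurable
    exact (by fun_prop : Measurable fun x =>
      a x * (transfer^[n] h x - transfer^[n] h 0)).aestronglyMeasurable
  · refine (ae_restrict_iff' measurableSet_Icc).mpr (ae_of_all _ fun x hx => ?_)
    rw [norm_mul, ← one_mul (1 : ℝ)]
    exact mul_le_mul (hab x hx) ((hh.iterate n).abs_sub_le_one hx h0) (norm_nonneg _) zero_le_one
  -- Pointwise convergence is known only off the two endpoints.
  · rw [← Measure.restrict_congr_set (μ := volume) (Ioo_ae_eq_Icc (a := (-1 : ℝ)) (b := 1))]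
    refine (ae_restrict_iff' measurableSet_Ioo).mpr (ae_of_all _ fun x hx => ?_)
    simpa using (tendsto_transfer_sub hh hx).const_mul (a x)

theorem setIntegral_mul_iterate_transfer {h a : ℝ → ℝ} (hh : IsMonotoneObservable h)
    (ha : Measurable a) (hab : ∀ x ∈ Icc (-1 : ℝ) 1, |a x| ≤ 1)
    (hinv : ∀ x ∈ Icc (-1 : ℝ) 1, a (intervalMap x) = a x) (n : ℕ) :
    ∫ x in Icc (-1 : ℝ) 1, a x * transfer^[n] h x = ∫ x in Icc (-1 : ℝ) 1, a x * h x := by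
  induction n with
  | zero => rfl
  | succ n ih =>
    rw [← ih, Function.iterate_succ_apply', ← setIntegral_comp_intervalMap_mul ha
      (hh.iterate n).measurable hab (hh.iterate n).abs_le_one]
    exact setIntegral_congr_fun measurableSet_Icc fun x hx => by simp only [hinv x hx]

/-- The iterates of a monotone observable converge to its mean. -/
theorem tendsto_transfer {h : ℝ → ℝ} (hh : IsMonotoneObservable h) {y : ℝ}
    (hy : y ∈ Ioo (-1 : ℝ) 1) :
    Tendsto (fun n => transfer^[n] h y) atTop (𝓝 ((∫ x in Icc (-1 : ℝ) 1, h x) / 2)) := by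
  have h1 := tendsto_setIntegral_mul_transfer hh (a := fun _ => 1) measurable_const (by simp)
  simp_rw [setIntegral_mul_iterate_transfer hh (a := fun _ => 1) measurable_const (by simp)
    (by simp)] at h1
  have hvol : ∫ _x in Icc (-1 : ℝ) 1, (1 : ℝ) = 2 := by simp; norm_num
  simp only [one_mul, hvol] at h1
  -- The integral is preserved by the operator, so `h1` identifies the limit of the values at `0` as
  -- the mean.
  have h2 := (((tendsto_const_nhds (x := ∫ x in Icc (-1 : ℝ) 1, h x)).sub h1).div_const 2).add
    (tendsto_transfer_sub hh hy)
  rw [sub_zero, add_zero] at h2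
  exact h2.congr fun n => by ring

/-- For invariant `a` the correlation with the iterates of `h` does not depend on `n`, while those
iterates become constant: so `a` is uncorrelated with `h`. -/
theorem setIntegral_mul_of_invariant {h a : ℝ → ℝ} (hh : IsMonotoneObservable h)
    (ha : Measurable a) (hab : ∀ x ∈ Icc (-1 : ℝ) 1, |a x| ≤ 1)
    (hinv : ∀ x ∈ Icc (-1 : ℝ) 1, a (intervalMap x) = a x) :
    ∫ x in Icc (-1 : ℝ) 1, a x * h x =
      (∫ x in Icc (-1 : ℝ) 1, h x) / 2 * ∫ x in Icc (-1 : ℝ) 1, a x := by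
  have h1 := tendsto_setIntegral_mul_transfer hh ha hab
  simp_rw [setIntegral_mul_iterate_transfer hh ha hab hinv] at h1
  have h2 := ((tendsto_transfer hh (y := 0) (by norm_num)).mul_const
    (∫ x in Icc (-1 : ℝ) 1, a x)).const_sub (∫ x in Icc (-1 : ℝ) 1, a x * h x)
  exact sub_eq_zero.mp (tendsto_nhds_unique h2 h1)

/-! ### Half-line indicators: ergodicity and covering -/

theorem isMonotoneObservable_indicator_Ici (s : ℝ) :
    IsMonotoneObservable ((Ici s).indicator fun _ => 1) where
  measurable := measurable_const.indicator measurableSet_Ici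
  nonneg := fun x _ => indicator_nonneg (fun _ _ => zero_le_one) x
  le_one := fun x _ => indicator_le_self' (fun _ _ => zero_le_one) x
  mono := by
    intro x _ y _ hxy
    by_cases hx : s ≤ x
    · rw [indicator_of_mem (mem_Ici.mpr hx), indicator_of_mem (mem_Ici.mpr (hx.trans hxy))]
    · rw [indicator_of_notMem (by simpa using hx)]
      exact indicator_nonneg (fun _ _ => zero_le_one) y

/-- Lebesgue measure on `[-1, 1]` is ergodic for `intervalMap`: invariant sets are trivial. -/
theorem volume_invariant_eq_zero {A : Set ℝ} (hA : MeasurableSet A)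
    (hinv : ∀ x ∈ Icc (-1 : ℝ) 1, intervalMap x ∈ A ↔ x ∈ A) :
    (volume.restrict (Icc (-1 : ℝ) 1)) A = 0 ∨ (volume.restrict (Icc (-1 : ℝ) 1)) Aᶜ = 0 := by
  set μ : Measure ℝ := volume.restrict (Icc (-1 : ℝ) 1) with hμ
  set c : ℝ := μ.real A / 2 with hc
  have hab : ∀ x ∈ Icc (-1 : ℝ) 1, |A.indicator (fun _ => (1 : ℝ)) x| ≤ 1 := fun x _ => by
    rw [abs_of_nonneg (indicator_nonneg (fun _ _ => zero_le_one) x)]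
    exact indicator_le_self' (fun _ _ => zero_le_one) x
  have hia : ∀ x ∈ Icc (-1 : ℝ) 1, A.indicator (fun _ => (1 : ℝ)) (intervalMap x) =
      A.indicator (fun _ => 1) x := fun x hx => by
    by_cases h : x ∈ A
    · rw [indicator_of_mem h, indicator_of_mem ((hinv x hx).mpr h)]
    · rw [indicator_of_notMem h, indicator_of_notMem (mt (hinv x hx).mp h)]
  have hind : ∀ {s : Set ℝ}, MeasurableSet s → ∫ x in Icc (-1 : ℝ) 1, s.indicator (fun _ => (1 : ℝ)) x
      = μ.real s := fun hs => integral_indicator_one hs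
  have key : ∀ s, μ.real (A ∩ Ici s) = c * μ.real (Ici s) := by
    intro s
    have h1 := setIntegral_mul_of_invariant (isMonotoneObservable_indicator_Ici s)
      (measurable_const.indicator hA) hab hia
    rw [hind measurableSet_Ici, hind hA] at h1
    rw [← hind (hA.inter measurableSet_Ici), hc]
    simp_rw [← inter_indicator_mul, one_mul] at h1
    rw [h1]
    ring
  -- Half-lines determine a finite measure, so `A` has constant density `c`. Evaluation on the
  -- complement of `A`, where the left side vanishes, leaves only trivial sets.
  have hext : μ.restrict A = ENNReal.ofReal c • μ := by
    refine Measure.ext_of_Ici _ _ fun s => ?_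
    rw [Measure.restrict_apply measurableSet_Ici, Measure.smul_apply, smul_eq_mul, inter_comm,
      ← ofReal_measureReal, key, ENNReal.ofReal_mul (by positivity), ofReal_measureReal]
  have h2 := congrArg (fun ν => ν Aᶜ) hext
  simp only [Measure.smul_apply, smul_eq_mul] at h2
  rw [Measure.restrict_apply hA.compl, compl_inter_self, measure_empty, eq_comm, mul_eq_zero] at h2
  refine h2.imp_left fun h => ?_
  rw [ENNReal.ofReal_eq_zero] at h
  rw [← measureReal_eq_zero_iff]
  exact le_antisymm (by linarith) measureReal_nonneg

/-- The iterated operator is a weighted sum of `h` over preimages, so a non-zero value needs a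
preimage where `h` is non-zero. -/
theorem exists_preimage_of_transfer_ne_zero {h : ℝ → ℝ} (n : ℕ) :
    ∀ y ∈ Icc (-1 : ℝ) 1, transfer^[n] h y ≠ 0 →
      ∃ x ∈ Icc (-1 : ℝ) 1, intervalMap^[n] x = y ∧ h x ≠ 0 := by
  induction n with
  | zero => exact fun y hy hne => ⟨y, hy, rfl, hne⟩
  | succ n ih =>
    intro y hy hne
    rw [Function.iterate_succ_apply'] at hne
    have hstep : ∃ z ∈ Icc (-1 : ℝ) 1, intervalMap z = y ∧ transfer^[n] h z ≠ 0 := by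
      by_contra! hcon
      apply hne
      have h1 := hcon _ ⟨by linarith [(posBranch_mem hy).1], (posBranch_mem hy).2⟩
        (intervalMap_posBranch hy.1)
      rw [transfer, h1, mul_zero, zero_add]
      -- At `y = 1` the negative branch point is no preimage of `y`, but its weight is zero.
      rcases hy.2.lt_or_eq with hy1 | rfl
      · rw [hcon _ ⟨(negBranch_mem hy).1, by linarith [(negBranch_mem hy).2]⟩
          (intervalMap_negBranch hy1), mul_zero]
      · simp
    obtain ⟨z, hz, hzy, hne'⟩ := hstep
    obtain ⟨x, hx, hxz, hx0⟩ := ih z hz hne'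
    exact ⟨x, hx, by rw [Function.iterate_succ_apply', hxz, hzy], hx0⟩

/-- The iterates of an interval eventually cover the middle half of `[-1, 1]`. -/
theorem exists_iterate_image_superset {s t : ℝ} (hs : -1 ≤ s) (hst : s < t) (ht : t ≤ 1) :
    ∃ n, Icc (-(1 / 2) : ℝ) (1 / 2) ⊆ intervalMap^[n] '' Ico s t := by
  set hS : ℝ → ℝ := (Ici s).indicator fun _ => 1
  set hT : ℝ → ℝ := (Ici t).indicator fun _ => 1
  have hlin : ∀ n, transfer^[n] (hS - hT) = transfer^[n] hS - transfer^[n] hT := by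
    intro n
    induction n with
    | zero => rfl
    | succ n ih =>
      simp only [Function.iterate_succ_apply', ih]
      funext y
      simp only [transfer, Pi.sub_apply]
      ring
  have hmean : ∀ r, -1 ≤ r → r ≤ 1 →
      ∫ x in Icc (-1 : ℝ) 1, (Ici r).indicator (fun _ => (1 : ℝ)) x = 1 - r := by
    intro r hr hr1
    have : Icc (-1 : ℝ) 1 ∩ Ici r = Icc r 1 := by
      ext x
      simp only [mem_inter_iff, mem_Icc, mem_Ici]
      constructor
      · rintro ⟨⟨-, h⟩, h'⟩; exact ⟨h', h⟩
      · rintro ⟨h, h'⟩; exact ⟨⟨hr.trans h, h'⟩, h⟩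
    rw [setIntegral_indicator measurableSet_Ici, this]
    simp [hr1]
  have l1 := tendsto_transfer (isMonotoneObservable_indicator_Ici s) (y := -(1 / 2)) (by norm_num)
  have l2 := tendsto_transfer (isMonotoneObservable_indicator_Ici t) (y := 1 / 2) (by norm_num)
  rw [hmean s hs (by linarith)] at l1
  rw [hmean t (by linarith) ht] at l2
  obtain ⟨n, hn⟩ := ((l1.sub l2).eventually_const_lt (u := 0) (by linarith)).exists
  refine ⟨n, fun y hy => ?_⟩
  have hyI : y ∈ Icc (-1 : ℝ) 1 := ⟨by linarith [hy.1], by linarith [hy.2]⟩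
  -- By monotonicity, comparing the first iterate at `-1/2` with the second at `1/2` settles all `y`
  -- in between; the limits there differ by `(t - s) / 2`.
  have hpos : transfer^[n] (hS - hT) y ≠ 0 := by
    have m1 := ((isMonotoneObservable_indicator_Ici s).iterate n).mono
      (a := -(1 / 2)) (by norm_num) hyI hy.1
    have m2 := ((isMonotoneObservable_indicator_Ici t).iterate n).mono
      hyI (b := 1 / 2) (by norm_num) hy.2
    rw [hlin, Pi.sub_apply]
    exact ne_of_gt (by linarith)
  obtain ⟨x, -, hxy, hne⟩ := exists_preimage_of_transfer_ne_zero n y hyI hpos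
  refine ⟨x, ⟨?_, ?_⟩, hxy⟩
  · by_contra! hlt
    simp [hS, hT, hlt, hlt.trans hst] at hne
  · by_contra! hle
    simp [hS, hT, hle, hst.le.trans hle] at hne

theorem measurePreserving_intervalMap :
    MeasurePreserving intervalMap (volume.restrict (Icc (-1) 1)) (volume.restrict (Icc (-1) 1)) := by
  refine ⟨measurable_intervalMap, Measure.ext fun s hs => ?_⟩
  have h := setIntegral_comp_intervalMap_mul (φ := s.indicator fun _ => 1) (h := fun _ => 1) (C := 1)
    (measurable_const.indicator hs) measurable_const (fun x _ => by
      rw [abs_of_nonneg (indicator_nonneg (fun _ _ => zero_le_one) x)]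
      exact indicator_le_self' (fun _ _ => zero_le_one) x) (by simp)
  have ht : transfer (fun _ => 1) = fun _ => 1 := by
    funext y
    simp only [transfer]
    ring
  rw [ht] at h
  simp only [mul_one] at h
  have e : ∀ x, s.indicator (fun _ => (1 : ℝ)) (intervalMap x) =
      (intervalMap ⁻¹' s).indicator (fun _ => 1) x := fun x => rfl
  simp_rw [e] at h
  have h1 := integral_indicator_one (μ := volume.restrict (Icc (-1 : ℝ) 1)) hs
  have h2 := integral_indicator_one (μ := volume.restrict (Icc (-1 : ℝ) 1))
    (measurable_intervalMap hs)
  rw [Measure.map_apply measurable_intervalMap hs, ← ofReal_measureReal, ← ofReal_measureReal,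
    ← h1, ← h2]
  exact congrArg _ h

/-! ### Points of the circle -/

theorem exists_coe_eq_of_Ico (x : S1) : ∃ t ∈ Ico (-1 : ℝ) 1, (t : S1) = x := by
  refine ⟨AddCircle.equivIco 2 (-1) x, ?_, AddCircle.coe_equivIco⟩
  have h := (AddCircle.equivIco (2 : ℝ) (-1) x).2
  exact ⟨h.1, h.2.trans_eq (by norm_num)⟩

theorem coe_one_eq_coe_neg_one : ((1 : ℝ) : S1) = ((-1 : ℝ) : S1) := by
  have := AddCircle.coe_add_period (2 : ℝ) (-1)
  norm_num at this
  simpa using this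

theorem coe_add_two (x : ℝ) : ((x + 2 : ℝ) : S1) = (x : S1) := AddCircle.coe_add_period 2 x

theorem norm_coe_of_abs_le_one {t : ℝ} (ht : |t| ≤ 1) : ‖(t : S1)‖ = |t| :=
  (AddCircle.norm_coe_eq_abs_iff 2 two_ne_zero).mpr (by simpa using ht)

theorem dist_coe_zero {t : ℝ} (ht : t ∈ Icc (-1 : ℝ) 1) : dist (t : S1) ((0 : ℝ) : S1) = |t| := by
  rw [dist_eq_norm, ← AddCircle.coe_sub, sub_zero, norm_coe_of_abs_le_one (abs_le.mpr ht)]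

theorem dist_coe_one {t : ℝ} (ht : t ∈ Icc (-1 : ℝ) 1) :
    dist (t : S1) ((1 : ℝ) : S1) = 1 - |t| := by
  rcases le_or_gt 0 t with h | h
  · have h1 : |t - 1| = 1 - t := by rw [abs_of_nonpos (by linarith [ht.2])]; ring
    rw [dist_eq_norm, ← AddCircle.coe_sub, norm_coe_of_abs_le_one (by rw [h1]; linarith), h1,
      abs_of_nonneg h]
  · have h1 : |t - -1| = 1 + t := by rw [abs_of_nonneg (by linarith [ht.1])]; ring
    rw [coe_one_eq_coe_neg_one, dist_eq_norm, ← AddCircle.coe_sub,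
      norm_coe_of_abs_le_one (by rw [h1]; linarith), h1, abs_of_neg h]
    ring

theorem infDist_excSet (x : S1) :
    Metric.infDist x excSet = min (dist x ((0 : ℝ) : S1)) (dist x ((1 : ℝ) : S1)) := by
  rw [Metric.infDist, excSet, insert_eq, Metric.infEDist_union, Metric.infEDist_singleton,
    Metric.infEDist_singleton, ENNReal.toReal_min (edist_ne_top _ _) (edist_ne_top _ _),
    dist_edist, dist_edist]

theorem infDist_excSet_coe {t : ℝ} (ht : t ∈ Icc (-1 : ℝ) 1) :
    Metric.infDist (t : S1) excSet = min |t| (1 - |t|) := by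
  rw [infDist_excSet, dist_coe_zero ht, dist_coe_one ht]

theorem coe_mem_excSet_iff {t : ℝ} (ht : t ∈ Icc (-1 : ℝ) 1) :
    (t : S1) ∈ excSet ↔ t = 0 ∨ |t| = 1 := by
  rw [excSet, mem_insert_iff, mem_singleton_iff, ← dist_eq_zero, ← dist_eq_zero (y := ((1 : ℝ) : S1)),
    dist_coe_zero ht, dist_coe_one ht, abs_eq_zero, sub_eq_zero, eq_comm (a := (1 : ℝ))]

/-! ### Local homeomorphism -/

/-- The homeomorphism `x ↦ sign x √|x|` of `[-1, 1]`, as a function on `ℝ`. -/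
noncomputable def signedSqrt (x : ℝ) : ℝ := √x - √(-x)

theorem signedSqrt_of_nonneg {x : ℝ} (hx : 0 ≤ x) : signedSqrt x = √x := by
  rw [signedSqrt, Real.sqrt_eq_zero_of_nonpos (by linarith : -x ≤ 0), sub_zero]

theorem signedSqrt_of_nonpos {x : ℝ} (hx : x ≤ 0) : signedSqrt x = -√(-x) := by
  rw [signedSqrt, Real.sqrt_eq_zero_of_nonpos hx, zero_sub]

theorem signedSqrt_sq (x : ℝ) : signedSqrt x ^ 2 = |x| := by
  rcases le_total 0 x with h | h
  · rw [signedSqrt_of_nonneg h, Real.sq_sqrt h, abs_of_nonneg h]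
  · rw [signedSqrt_of_nonpos h, neg_sq, Real.sq_sqrt (by linarith), abs_of_nonpos h]

theorem continuous_signedSqrt : Continuous signedSqrt := by
  unfold signedSqrt
  fun_prop

theorem signedSqrt_mul_abs (x : ℝ) : signedSqrt x * |signedSqrt x| = x := by
  rcases le_total 0 x with h | h
  · rw [signedSqrt_of_nonneg h, abs_of_nonneg (Real.sqrt_nonneg _), Real.mul_self_sqrt h]
  · rw [signedSqrt_of_nonpos h, abs_neg, abs_of_nonneg (Real.sqrt_nonneg _), neg_mul,
      Real.mul_self_sqrt (by linarith), neg_neg]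

theorem abs_signedSqrt_le_one {x : ℝ} (hx : |x| ≤ 1) : |signedSqrt x| ≤ 1 := by
  rw [← sq_le_one_iff_abs_le_one, signedSqrt_sq]
  exact hx

theorem signedSqrt_self_mul_abs (y : ℝ) : signedSqrt (y * |y|) = y := by
  rcases le_total 0 y with h | h
  · rw [abs_of_nonneg h, signedSqrt_of_nonneg (mul_self_nonneg y), Real.sqrt_mul_self h]
  · rw [abs_of_nonpos h, signedSqrt_of_nonpos (by nlinarith), show -(y * -y) = -y * -y by ring,
      Real.sqrt_mul_self (by linarith), neg_neg]

/-- The circle map induced by a map of `[-1, 1]` fixing the endpoints. -/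
noncomputable def circleExt (r : ℝ → ℝ) : S1 → S1 :=
  AddCircle.liftIco 2 (-1) fun x => (r x : S1)

theorem circleExt_coe {r : ℝ → ℝ} (h1 : r 1 = 1) (h2 : r (-1) = -1) {x : ℝ}
    (hx : x ∈ Icc (-1 : ℝ) 1) : circleExt r (x : S1) = (r x : S1) := by
  rcases hx.2.eq_or_lt with rfl | h
  · rw [h1, coe_one_eq_coe_neg_one, circleExt, AddCircle.liftIco_coe_apply (by norm_num), h2]
  · exact AddCircle.liftIco_coe_apply ⟨hx.1, by linarith⟩

theorem continuous_circleExt {r : ℝ → ℝ} (hr : Continuous r) (h1 : r 1 = 1) (h2 : r (-1) = -1) :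
    Continuous (circleExt r) := by
  refine AddCircle.liftIco_continuous ?_ (((AddCircle.continuous_mk' 2).comp hr).continuousOn)
  rw [show (-1 : ℝ) + 2 = 1 by norm_num, h1, h2, coe_one_eq_coe_neg_one]

theorem signedSqrt_one : signedSqrt 1 = 1 := by
  rw [signedSqrt_of_nonneg zero_le_one, Real.sqrt_one]

theorem signedSqrt_neg_one : signedSqrt (-1) = -1 := by
  rw [signedSqrt_of_nonpos (by norm_num), neg_neg, Real.sqrt_one]

/-- The circle homeomorphism `x ↦ sign x √|x|`. -/
noncomputable def circleSqrt : S1 ≃ₜ S1 where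
  toFun := circleExt signedSqrt
  invFun := circleExt fun y => y * |y|
  left_inv x := by
    obtain ⟨t, ht, rfl⟩ := exists_coe_eq_of_Ico x
    have ht' : t ∈ Icc (-1 : ℝ) 1 := Ico_subset_Icc_self ht
    rw [circleExt_coe signedSqrt_one signedSqrt_neg_one ht', circleExt_coe (by simp) (by simp)
      (abs_le.mp (abs_signedSqrt_le_one (abs_le.mpr ht'))), signedSqrt_mul_abs]
  right_inv y := by
    obtain ⟨t, ht, rfl⟩ := exists_coe_eq_of_Ico y
    have ht' : t ∈ Icc (-1 : ℝ) 1 := Ico_subset_Icc_self ht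
    have habs := abs_le.mpr ht'
    rw [circleExt_coe (by simp) (by simp) ht', circleExt_coe signedSqrt_one signedSqrt_neg_one
      (abs_le.mp ?_), signedSqrt_self_mul_abs]
    rw [abs_mul, abs_abs]
    exact mul_le_one₀ habs (abs_nonneg _) habs
  continuous_toFun := continuous_circleExt continuous_signedSqrt signedSqrt_one signedSqrt_neg_one
  continuous_invFun := continuous_circleExt (by fun_prop) (by simp) (by simp)

/-- Modulo `2` the two formulas merge into one, which exhibits the map as the signed square root, a
homeomorphism, followed by the local homeomorphism `y ↦ 2y - 1`. -/
theorem mannevilleMap_coe_eq_signedSqrt {t : ℝ} (ht : t ∈ Icc (-1 : ℝ) 1) :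
    mannevilleMap (t : S1) = ((2 * signedSqrt t - 1 : ℝ) : S1) := by
  rw [mannevilleMap_coe ht]
  rcases le_or_gt 0 t with h | h
  · rw [intervalMap_of_nonneg h, signedSqrt_of_nonneg h]
  · rw [intervalMap_of_neg h, signedSqrt_of_nonpos h.le, ← coe_add_two (_ - 1)]
    congr 1
    ring

theorem isLocalHomeomorph_double : IsLocalHomeomorph fun y : S1 => y + y - ((1 : ℝ) : S1) := by
  have hcoe : IsLocalHomeomorph ((↑) : ℝ → S1) := AddCircle.isLocalHomeomorph_coe 2
  have hcomp : (fun y : S1 => y + y - ((1 : ℝ) : S1)) ∘ ((↑) : ℝ → S1) =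
      ((↑) : ℝ → S1) ∘ affineHomeomorph (2 : ℝ) (-1) two_ne_zero := by
    funext u
    simp only [Function.comp_apply, affineHomeomorph_apply, ← AddCircle.coe_add,
      ← AddCircle.coe_sub]
    congr 1
    ring
  -- The lift to the line is an affine homeomorphism; the surjective covering map is then cancelled
  -- on the right.
  have h := (hcoe.comp (affineHomeomorph (2 : ℝ) (-1) two_ne_zero).isLocalHomeomorph)
  rw [← hcomp] at h
  have h2 := (h.isLocalHomeomorphOn (s := univ)).of_comp_right hcoe.isLocalHomeomorphOn
  rwa [image_univ, range_eq_univ.mpr QuotientAddGroup.mk_surjective,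
    ← isLocalHomeomorph_iff_isLocalHomeomorphOn_univ] at h2

theorem isLocalHomeomorph_mannevilleMap : IsLocalHomeomorph mannevilleMap := by
  convert isLocalHomeomorph_double.comp circleSqrt.isLocalHomeomorph using 1
  funext x
  obtain ⟨t, ht, rfl⟩ := exists_coe_eq_of_Ico x
  have ht' : t ∈ Icc (-1 : ℝ) 1 := Ico_subset_Icc_self ht
  have e : circleSqrt (t : S1) = (signedSqrt t : S1) :=
    circleExt_coe signedSqrt_one signedSqrt_neg_one ht'
  rw [mannevilleMap_coe_eq_signedSqrt ht', Function.comp_apply, e, ← AddCircle.coe_add,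
    ← AddCircle.coe_sub, two_mul]

/-! ### Derivatives -/

/-- While the increment of the lift stays within `(-1, 1)`, it is its own representative in the
chart. -/
theorem chartExpr_eventuallyEq {f : S1 → S1} {G : ℝ → ℝ} {t : ℝ} (hG : ContinuousAt G t)
    (h : ∀ᶠ u : ℝ in 𝓝 t, f (u : S1) = (G u : S1)) :
    chartExpr f (t : S1) =ᶠ[𝓝 0] fun s => G (t + s) - G t := by
  have htend : Tendsto (fun s : ℝ => t + s) (𝓝 0) (𝓝 t) := by
    simpa using (continuous_const_add t).tendsto 0
  have h1 := htend.eventually h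
  have h2 : ∀ᶠ s in 𝓝 (0 : ℝ), G (t + s) ∈ Ioo (G t - 1) (G t + 1) :=
    (hG.tendsto.comp htend) (Ioo_mem_nhds (by linarith) (by linarith))
  filter_upwards [h1, h2] with s hs hs2
  rw [chartExpr, ← AddCircle.coe_add, hs, h.self_of_nhds, ← AddCircle.coe_sub]
  exact AddCircle.equivIco_coe_of_mem ⟨by linarith [hs2.1], by linarith [hs2.2]⟩

theorem mannevilleMap_eventuallyEq {t : ℝ} (ht : t ∈ Ioo (-1 : ℝ) 1) :
    ∀ᶠ u : ℝ in 𝓝 t, mannevilleMap (u : S1) = ((2 * signedSqrt u - 1 : ℝ) : S1) := by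
  filter_upwards [isOpen_Ioo.mem_nhds ht] with u hu
  exact mannevilleMap_coe_eq_signedSqrt (Ioo_subset_Icc_self hu)

theorem signedSqrt_eventuallyEq_of_pos {t : ℝ} (ht : 0 < t) :
    (fun u => 2 * signedSqrt u - 1) =ᶠ[𝓝 t] fun u => 2 * √u - 1 := by
  filter_upwards [lt_mem_nhds ht] with u hu
  rw [signedSqrt_of_nonneg hu.le]

theorem signedSqrt_eventuallyEq_of_neg {t : ℝ} (ht : t < 0) :
    (fun u => 2 * signedSqrt u - 1) =ᶠ[𝓝 t] fun u => -(2 * √(-u)) - 1 := by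
  filter_upwards [gt_mem_nhds ht] with u hu
  rw [signedSqrt_of_nonpos hu.le]
  ring

theorem contDiffAt_lift {t : ℝ} (ht : t ≠ 0) :
    ContDiffAt ℝ 2 (fun u => 2 * signedSqrt u - 1) t := by
  rcases ht.lt_or_gt with h | h
  · refine ContDiffAt.congr_of_eventuallyEq ?_ (signedSqrt_eventuallyEq_of_neg h)
    exact ((contDiffAt_const.mul (contDiffAt_id.neg.sqrt (neg_ne_zero.mpr ht))).neg).sub
      contDiffAt_const
  · refine ContDiffAt.congr_of_eventuallyEq ?_ (signedSqrt_eventuallyEq_of_pos h)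
    exact (contDiffAt_const.mul (contDiffAt_id.sqrt ht)).sub contDiffAt_const

theorem hasDerivAt_lift {t : ℝ} (ht : t ≠ 0) :
    HasDerivAt (fun u => 2 * signedSqrt u - 1) (√|t|)⁻¹ t := by
  rcases ht.lt_or_gt with h | h
  · refine HasDerivAt.congr_of_eventuallyEq ?_ (signedSqrt_eventuallyEq_of_neg h)
    have h1 := ((((hasDerivAt_id t).fun_neg.sqrt (neg_ne_zero.mpr ht)).const_mul 2).fun_neg).sub_const 1
    refine h1.congr_deriv ?_
    have : √(-t) ≠ 0 := (Real.sqrt_pos.mpr (by linarith)).ne'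
    rw [abs_of_neg h]
    simp only [id]
    field_simp
  · refine HasDerivAt.congr_of_eventuallyEq ?_ (signedSqrt_eventuallyEq_of_pos h)
    have h1 := (((hasDerivAt_id t).sqrt ht).const_mul 2).sub_const 1
    refine h1.congr_deriv ?_
    have : √t ≠ 0 := (Real.sqrt_pos.mpr h).ne'
    rw [abs_of_pos h]
    simp only [id]
    field_simp

theorem chartExpr_mannevilleMap {t : ℝ} (ht : t ∈ Ioo (-1 : ℝ) 1) :
    chartExpr mannevilleMap (t : S1) =ᶠ[𝓝 0]
      fun s => 2 * signedSqrt (t + s) - 1 - (2 * signedSqrt t - 1) :=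
  chartExpr_eventuallyEq (G := fun u => 2 * signedSqrt u - 1)
    (((continuous_const.mul continuous_signedSqrt).sub continuous_const).continuousAt)
    (mannevilleMap_eventuallyEq ht)

theorem hasDerivAt_chartExpr {t : ℝ} (ht : t ∈ Ioo (-1 : ℝ) 1) (h0 : t ≠ 0) :
    HasDerivAt (chartExpr mannevilleMap (t : S1)) (√|t|)⁻¹ 0 := by
  refine HasDerivAt.congr_of_eventuallyEq ?_ (chartExpr_mannevilleMap ht)
  refine HasDerivAt.sub_const (f := fun s => 2 * signedSqrt (t + s) - 1) _ ?_
  refine HasDerivAt.comp_const_add (f := fun u => 2 * signedSqrt u - 1) t 0 ?_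
  rw [add_zero]
  exact hasDerivAt_lift h0

theorem contDiffAt_chartExpr {t : ℝ} (ht : t ∈ Ioo (-1 : ℝ) 1) (h0 : t ≠ 0) :
    ContDiffAt ℝ 2 (chartExpr mannevilleMap (t : S1)) 0 := by
  refine ContDiffAt.congr_of_eventuallyEq ?_ (chartExpr_mannevilleMap ht)
  have h1 : ContDiffAt ℝ 2 (fun u => 2 * signedSqrt u - 1) (t + 0) := by
    rw [add_zero]
    exact contDiffAt_lift h0
  exact (h1.comp (0 : ℝ) (contDiffAt_const.add contDiffAt_id)).sub contDiffAt_const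

theorem not_differentiableAt_chartExpr_zero :
    ¬ DifferentiableAt ℝ (chartExpr mannevilleMap ((0 : ℝ) : S1)) 0 := by
  intro h
  apply not_differentiableAt_abs_zero
  -- Near `0` the square of half the chart expression is `|s|`.
  refine ((h.div_const 2).pow 2).congr_of_eventuallyEq ?_
  filter_upwards [chartExpr_mannevilleMap (t := 0) (by norm_num)] with s hs
  have : signedSqrt 0 = 0 := by rw [signedSqrt_of_nonneg le_rfl, Real.sqrt_zero]
  rw [Pi.pow_apply, hs, ← signedSqrt_sq, zero_add, this]
  ring

/-- The expression of the map near the point `1` in the chart centred there. -/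
noncomputable def chartAtOne (s : ℝ) : ℝ := if s ≤ 0 then 2 * √(1 + s) - 2 else 2 - 2 * √(1 - s)

theorem chartAtOne_of_nonpos {s : ℝ} (hs : s ≤ 0) : chartAtOne s = 2 * √(1 + s) - 2 := if_pos hs

theorem chartAtOne_of_nonneg {s : ℝ} (hs : 0 ≤ s) : chartAtOne s = 2 - 2 * √(1 - s) := by
  rcases hs.eq_or_lt with rfl | h
  · simp [chartAtOne]
  · exact if_neg (not_le.mpr h)

theorem hasDerivAt_chartAtOne {s : ℝ} (hs : s ∈ Ioo (-1 : ℝ) 1) :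
    HasDerivAt chartAtOne (√(1 - |s|))⁻¹ s := by
  have hneg : HasDerivAt (fun s => 2 * √(1 + s) - 2) (√(1 + s))⁻¹ s := by
    have h0 : 0 < 1 + s := by linarith [hs.1]
    have h1 := ((((hasDerivAt_id s).const_add 1).sqrt h0.ne').const_mul 2).sub_const 2
    refine h1.congr_deriv ?_
    have : √(1 + s) ≠ 0 := (Real.sqrt_pos.mpr h0).ne'
    simp only [id]
    field_simp
  have hpos : HasDerivAt (fun s => 2 - 2 * √(1 - s)) (√(1 - s))⁻¹ s := by
    have h0 : 0 < 1 - s := by linarith [hs.2]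
    have h1 := ((((hasDerivAt_id s).const_sub 1).sqrt h0.ne').const_mul 2).const_sub 2
    refine h1.congr_deriv ?_
    have : √(1 - s) ≠ 0 := (Real.sqrt_pos.mpr h0).ne'
    simp only [id]
    field_simp
  rcases lt_trichotomy s 0 with h | rfl | h
  · rw [abs_of_neg h, sub_neg_eq_add]
    refine hneg.congr_of_eventuallyEq ?_
    filter_upwards [gt_mem_nhds h] with u hu
    exact chartAtOne_of_nonpos hu.le
  · have h1 : HasDerivWithinAt chartAtOne (√(1 - |(0 : ℝ)|))⁻¹ (Iic 0) 0 := by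
      have := (hneg.hasDerivWithinAt (s := Iic 0)).congr (f₁ := chartAtOne)
        (fun u hu => chartAtOne_of_nonpos hu) (chartAtOne_of_nonpos le_rfl)
      simpa using this
    have h2 : HasDerivWithinAt chartAtOne (√(1 - |(0 : ℝ)|))⁻¹ (Ici 0) 0 := by
      have := (hpos.hasDerivWithinAt (s := Ici 0)).congr (f₁ := chartAtOne)
        (fun u hu => chartAtOne_of_nonneg hu) (chartAtOne_of_nonneg le_rfl)
      simpa using this
    have h3 := h1.union h2
    rwa [Iic_union_Ici, hasDerivWithinAt_univ] at h3
  · rw [abs_of_pos h]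
    refine hpos.congr_of_eventuallyEq ?_
    filter_upwards [lt_mem_nhds h] with u hu
    exact chartAtOne_of_nonneg hu.le

theorem chartExpr_mannevilleMap_one :
    chartExpr mannevilleMap ((1 : ℝ) : S1) =ᶠ[𝓝 0] chartAtOne := by
  have hcont : ContinuousAt (fun u => chartAtOne (u - 1) + 1) 1 := by
    have h : ContinuousAt chartAtOne (1 - 1) := by
      rw [sub_self]
      exact (hasDerivAt_chartAtOne (by norm_num)).continuousAt
    exact (ContinuousAt.comp (f := fun u : ℝ => u - 1) h (by fun_prop)).add continuousAt_const
  have hlift : ∀ᶠ u : ℝ in 𝓝 (1 : ℝ), mannevilleMap (u : S1) = ((chartAtOne (u - 1) + 1 : ℝ) : S1) := by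
    filter_upwards [Ioo_mem_nhds (show (0 : ℝ) < 1 by norm_num) (show (1 : ℝ) < 2 by norm_num)]
      with u hu
    rcases le_or_gt u 1 with h | h
    · rw [mannevilleMap_coe ⟨by linarith [hu.1], h⟩, intervalMap_of_nonneg hu.1.le,
        chartAtOne_of_nonpos (by linarith)]
      congr 1
      ring_nf
    -- Beyond `1` the representative is `u - 2`, and its image is shifted back by a period.
    · rw [← sub_add_cancel u 2, coe_add_two, mannevilleMap_coe ⟨by linarith, by linarith [hu.2]⟩,
        intervalMap_of_neg (by linarith [hu.2]), chartAtOne_of_nonneg (by linarith),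
        ← coe_add_two]
      congr 1
      ring_nf
  filter_upwards [chartExpr_eventuallyEq (G := fun u => chartAtOne (u - 1) + 1) hcont hlift]
    with s hs
  rw [hs]
  simp [chartAtOne_of_nonpos]

theorem hasDerivAt_chartExpr_one : HasDerivAt (chartExpr mannevilleMap ((1 : ℝ) : S1)) 1 0 := by
  have := (hasDerivAt_chartAtOne (s := 0) (by norm_num)).congr_of_eventuallyEq
    chartExpr_mannevilleMap_one
  simpa using this

theorem not_contDiffAt_chartExpr_one :
    ¬ ContDiffAt ℝ 2 (chartExpr mannevilleMap ((1 : ℝ) : S1)) 0 := by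
  intro h
  have h1 : ContDiffAt ℝ 2 chartAtOne 0 := h.congr_of_eventuallyEq chartExpr_mannevilleMap_one.symm
  have h2 : DifferentiableAt ℝ (fderiv ℝ chartAtOne) 0 :=
    (h1.fderiv_right (m := 1) (by norm_num)).differentiableAt one_ne_zero
  have h3 : DifferentiableAt ℝ (fun s => fderiv ℝ chartAtOne s 1) 0 :=
    h2.clm_apply (differentiableAt_const _)
  have h4 : (fun s => fderiv ℝ chartAtOne s 1) =ᶠ[𝓝 0] fun s => (√(1 - |s|))⁻¹ := by
    filter_upwards [Ioo_mem_nhds (show (-1 : ℝ) < 0 by norm_num) (show (0 : ℝ) < 1 by norm_num)]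
      with s hs
    rw [fderiv_apply_one_eq_deriv, (hasDerivAt_chartAtOne hs).deriv]
  have h5 := h3.congr_of_eventuallyEq h4.symm
  apply not_differentiableAt_abs_zero
  -- The derivative `d = (√(1 - |s|))⁻¹` has a corner at `0`, since `1 - d⁻¹ ^ 2 = |s|`.
  refine (((h5.fun_inv (by simp)).pow 2).const_sub 1).congr_of_eventuallyEq ?_
  filter_upwards [Ioo_mem_nhds (show (-1 : ℝ) < 0 by norm_num) (show (0 : ℝ) < 1 by norm_num)]
    with s hs
  have : |s| ≤ 1 := abs_le.mpr ⟨hs.1.le, hs.2.le⟩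
  simp only [Pi.pow_apply, inv_inv]
  rw [Real.sq_sqrt (by linarith)]
  ring

theorem differentiableAt_chartExpr_iff (x : S1) :
    DifferentiableAt ℝ (chartExpr mannevilleMap x) 0 ↔ x ≠ ((0 : ℝ) : S1) := by
  constructor
  · rintro h rfl
    exact not_differentiableAt_chartExpr_zero h
  · intro hx
    obtain ⟨t, ht, rfl⟩ := exists_coe_eq_of_Ico x
    rcases ht.1.eq_or_lt with rfl | h
    · rw [← coe_one_eq_coe_neg_one]
      exact hasDerivAt_chartExpr_one.differentiableAt
    · exact (hasDerivAt_chartExpr ⟨h, ht.2⟩ (by rintro rfl; exact hx rfl)).differentiableAt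

theorem circleDeriv_coe {t : ℝ} (ht : t ∈ Icc (-1 : ℝ) 1) :
    circleDeriv mannevilleMap (t : S1) = (√|t|)⁻¹ := by
  have h1 : circleDeriv mannevilleMap ((1 : ℝ) : S1) = 1 := hasDerivAt_chartExpr_one.deriv
  rcases ht.1.eq_or_lt with rfl | hl
  · rw [← coe_one_eq_coe_neg_one, h1]
    simp
  rcases ht.2.eq_or_lt with rfl | hr
  · rw [h1]
    simp
  by_cases h0 : t = 0
  · subst h0
    -- At `0` both sides take the default value `0`, so the formula needs no exception.
    rw [circleDeriv, deriv_zero_of_not_differentiableAt not_differentiableAt_chartExpr_zero]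
    simp
  · exact (hasDerivAt_chartExpr ⟨hl, hr⟩ h0).deriv

theorem invDerivNorm_coe {t : ℝ} (ht : t ∈ Icc (-1 : ℝ) 1) :
    invDerivNorm mannevilleMap (t : S1) = √|t| := by
  rw [invDerivNorm, circleDeriv_coe ht, abs_of_nonneg (by positivity), inv_inv]

theorem mem_excSet_iff (x : S1) : x ∈ excSet ↔ ¬ IsC2LocalDiffeoAt mannevilleMap x := by
  constructor
  · rintro (rfl | rfl)
    · exact fun h => not_differentiableAt_chartExpr_zero (h.1.differentiableAt two_ne_zero)
    · exact fun h => not_contDiffAt_chartExpr_one h.1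
  · intro h
    obtain ⟨t, ht, rfl⟩ := exists_coe_eq_of_Ico x
    rw [coe_mem_excSet_iff (Ico_subset_Icc_self ht)]
    by_contra! hcon
    have hl : -1 < t := ht.1.lt_of_ne fun h => hcon.2 (by rw [← h]; simp)
    refine h ⟨contDiffAt_chartExpr ⟨hl, ht.2⟩ hcon.1, ?_⟩
    rw [circleDeriv_coe (Ico_subset_Icc_self ht)]
    have := abs_pos.mpr hcon.1
    positivity

/-! ### Non-degeneracy of the exceptional set -/

theorem abs_log_sqrt_sub_le {a b d e : ℝ} (ha : 0 < a) (hb : 0 < b) (hd : 0 < d) (hda : d ≤ a)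
    (hab : |a - b| ≤ e) (he : e < d / 2) : |Real.log (√a) - Real.log (√b)| ≤ 2 / d * e := by
  have key : ∀ u v : ℝ, 0 < u → d / 2 ≤ v → |u - v| ≤ e → Real.log u - Real.log v ≤ 2 / d * e := by
    intro u v hu hv huv
    have hv0 : 0 < v := by linarith
    rw [← Real.log_div hu.ne' hv0.ne']
    calc Real.log (u / v) ≤ u / v - 1 := Real.log_le_sub_one_of_pos (by positivity)
      _ = (u - v) / v := by field_simp
      _ ≤ e / (d / 2) :=
          div_le_div₀ ((abs_nonneg _).trans huv) ((le_abs_self _).trans huv) (by linarith) hv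
      _ = 2 / d * e := by field_simp
  have he0 : 0 ≤ e := (abs_nonneg _).trans hab
  have hbd : d / 2 ≤ b := by linarith [le_abs_self (a - b)]
  have h1 := key a b ha hbd hab
  have h2 := key b a hb (by linarith) (by rwa [abs_sub_comm])
  have h3 : 0 ≤ 2 / d * e := by positivity
  rw [Real.log_sqrt ha.le, Real.log_sqrt hb.le, abs_le]
  constructor <;> linarith

theorem isNondegenerateExceptionalSet_excSet :
    IsNondegenerateExceptionalSet mannevilleMap excSet 2 1 := by
  have hrep : ∀ x ∉ excSet, ∃ t ∈ Icc (-1 : ℝ) 1, (t : S1) = x ∧ 0 < |t| ∧ |t| < 1 := by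
    intro x hx
    obtain ⟨t, ht, rfl⟩ := exists_coe_eq_of_Ico x
    have ht' := Ico_subset_Icc_self ht
    rw [coe_mem_excSet_iff ht', not_or] at hx
    exact ⟨t, ht', rfl, abs_pos.mpr hx.1, (abs_le.mpr ht').lt_of_ne hx.2⟩
  have hlip : ∀ x ∉ excSet, ∀ y ∉ excSet, dist x y < Metric.infDist x excSet / 2 →
      |Real.log (invDerivNorm mannevilleMap x) - Real.log (invDerivNorm mannevilleMap y)|
        ≤ 2 / Metric.infDist x excSet ^ (1 : ℝ) * dist x y := by
    intro x hx y hy hxy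
    obtain ⟨t, ht, rfl, h0, h1⟩ := hrep x hx
    obtain ⟨u, hu, rfl, hu0, hu1⟩ := hrep y hy
    -- The derivative depends only on the distance to `0`, which varies by at most `dist x y`.
    have htri := abs_dist_sub_le (t : S1) (u : S1) ((0 : ℝ) : S1)
    rw [dist_coe_zero ht, dist_coe_zero hu] at htri
    rw [invDerivNorm_coe ht, invDerivNorm_coe hu, Real.rpow_one]
    rw [infDist_excSet_coe ht] at hxy ⊢
    exact abs_log_sqrt_sub_le h0 hu0 (lt_min h0 (by linarith)) (min_le_left _ _) htri hxy
  refine ⟨by simp [excSet], one_lt_two, one_pos, fun x hx => ?_, fun x hx => ?_, fun x hx => ?_,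
    hlip, fun x hx y hy hxy => ?_⟩
  · by_contra h
    exact hx ((mem_excSet_iff x).mpr h)
  · obtain ⟨t, ht, rfl, h0, h1⟩ := hrep x hx
    rw [circleDeriv_coe ht, infDist_excSet_coe ht, Real.rpow_one,
      abs_of_nonneg (inv_nonneg.mpr (Real.sqrt_nonneg |t|))]
    have h2 : 1 ≤ (√|t|)⁻¹ :=
      (one_le_inv₀ (Real.sqrt_pos.mpr h0)).mpr (Real.sqrt_le_one.mpr h1.le)
    have h3 := min_le_left |t| (1 - |t|)
    linarith
  · obtain ⟨t, ht, rfl, h0, h1⟩ := hrep x hx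
    rw [circleDeriv_coe ht, infDist_excSet_coe ht, Real.rpow_neg_one,
      abs_of_nonneg (inv_nonneg.mpr (Real.sqrt_nonneg |t|))]
    have hd : 0 < min |t| (1 - |t|) := lt_min h0 (by linarith)
    have h2 : |t| ≤ √|t| := (Real.le_sqrt' h0).mpr (by nlinarith)
    have h3 : (√|t|)⁻¹ ≤ (min |t| (1 - |t|))⁻¹ :=
      inv_anti₀ hd ((min_le_left _ _).trans h2)
    have : 0 ≤ (min |t| (1 - |t|))⁻¹ := by positivity
    linarith
  · have h := hlip x hx y hy hxy
    simp only [invDerivNorm, Real.log_inv] at h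
    rwa [neg_sub_neg, abs_sub_comm] at h

/-! ### Dynamics on the circle -/

theorem iterate_mannevilleMap_coe (n : ℕ) :
    ∀ t ∈ Icc (-1 : ℝ) 1, mannevilleMap^[n] (t : S1) = (intervalMap^[n] t : S1) := by
  induction n with
  | zero => exact fun t _ => rfl
  | succ n ih =>
    intro t ht
    rw [Function.iterate_succ_apply, mannevilleMap_coe ht, ih _ (intervalMap_mem_Icc ht),
      Function.iterate_succ_apply]

/-- Choosing the branch by the sign of `u` gives a preimage of modulus at most `1/4`. -/
theorem exists_intervalMap_eq {u : ℝ} (hu : u ∈ Ico (-1 : ℝ) 1) :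
    ∃ z ∈ Icc (-(1 / 2) : ℝ) (1 / 2), intervalMap z = u := by
  rcases le_or_gt u 0 with h | h
  · exact ⟨_, ⟨by nlinarith [sq_nonneg ((1 + u) / 2)], by nlinarith [hu.1]⟩,
      intervalMap_posBranch hu.1⟩
  · exact ⟨_, ⟨by nlinarith [hu.2], by nlinarith [sq_nonneg ((1 - u) / 2)]⟩,
      intervalMap_negBranch hu.2⟩

theorem exists_iterate_image_eq_univ {J : Set S1} (hJ : IsOpen J) (hne : J.Nonempty) :
    ∃ N : ℕ, mannevilleMap^[N] '' J = univ := by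
  obtain ⟨x, hx⟩ := hne
  obtain ⟨s, hs, rfl⟩ := exists_coe_eq_of_Ico x
  have hpre : ((↑) : ℝ → S1) ⁻¹' J ∈ 𝓝 s :=
    (hJ.preimage (AddCircle.continuous_mk' 2)).mem_nhds hx
  obtain ⟨t, hst, ht⟩ := exists_Ico_subset_of_mem_nhds hpre ⟨1, hs.2⟩
  obtain ⟨n, hn⟩ := exists_iterate_image_superset hs.1 (lt_min hst hs.2) (min_le_right t 1)
  refine ⟨n + 1, eq_univ_of_forall fun y => ?_⟩
  obtain ⟨u, hu, rfl⟩ := exists_coe_eq_of_Ico y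
  obtain ⟨z, hz, rfl⟩ := exists_intervalMap_eq hu
  obtain ⟨w, hw, rfl⟩ := hn hz
  have hwI : w ∈ Icc (-1 : ℝ) 1 := ⟨hs.1.trans hw.1, hw.2.le.trans (min_le_right _ _)⟩
  refine ⟨(w : S1), ht ⟨hw.1, hw.2.trans_le (min_le_left _ _)⟩, ?_⟩
  rw [iterate_mannevilleMap_coe _ _ hwI, Function.iterate_succ_apply']

theorem surjective_mannevilleMap : Function.Surjective mannevilleMap := by
  intro y
  obtain ⟨u, hu, rfl⟩ := exists_coe_eq_of_Ico y
  obtain ⟨z, hz, rfl⟩ := exists_intervalMap_eq hu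
  exact ⟨(z : S1), mannevilleMap_coe ⟨by linarith [hz.1], by linarith [hz.2]⟩⟩

theorem isTopologicallyMixing_mannevilleMap : IsTopologicallyMixing mannevilleMap := by
  intro U V hU _ hUne hVne
  obtain ⟨N, hN⟩ := exists_iterate_image_eq_univ hU hUne
  refine ⟨N, fun n hn => ?_⟩
  have : mannevilleMap^[n] '' U = univ := by
    rw [← Nat.sub_add_cancel hn, Function.iterate_add, image_comp, hN, image_univ,
      (surjective_mannevilleMap.iterate _).range_eq]
  rwa [this, univ_inter]

theorem leb_eq_map : leb = (2 : ℝ≥0∞)⁻¹ •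
    (volume.restrict (Icc (-1 : ℝ) 1)).map ((↑) : ℝ → S1) := by
  have h := (AddCircle.measurePreserving_mk 2 (-1)).map_eq
  rw [show (-1 : ℝ) + 2 = 1 by norm_num, Measure.restrict_congr_set Ioc_ae_eq_Icc] at h
  -- The factor `1/2` normalises the total length `2` of the circle.
  refine Eq.trans ?_ (congrArg (fun ν => (2 : ℝ≥0∞)⁻¹ • ν) h.symm)
  simp only [AddCircle.volume_eq_smul_haarAddCircle, smul_smul]
  rw [ENNReal.ofReal_ofNat, ENNReal.inv_mul_cancel two_ne_zero ENNReal.ofNat_ne_top, one_smul]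

theorem measurable_coe : Measurable ((↑) : ℝ → S1) := (AddCircle.continuous_mk' 2).measurable

theorem leb_apply {s : Set S1} (hs : MeasurableSet s) :
    leb s = 2⁻¹ * (volume.restrict (Icc (-1 : ℝ) 1)) (((↑) : ℝ → S1) ⁻¹' s) := by
  rw [leb_eq_map, Measure.smul_apply, Measure.map_apply measurable_coe hs, smul_eq_mul]

theorem measurePreserving_mannevilleMap : MeasurePreserving mannevilleMap leb leb := by
  have hm : Measurable mannevilleMap := isLocalHomeomorph_mannevilleMap.continuous.measurable
  refine ⟨hm, ?_⟩
  rw [leb_eq_map, Measure.map_smul, Measure.map_map hm measurable_coe]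
  have h : mannevilleMap ∘ ((↑) : ℝ → S1) =ᵐ[volume.restrict (Icc (-1 : ℝ) 1)]
      ((↑) : ℝ → S1) ∘ intervalMap :=
    (ae_restrict_iff' measurableSet_Icc).mpr (ae_of_all _ fun t ht => mannevilleMap_coe ht)
  rw [Measure.map_congr h, ← Measure.map_map measurable_coe measurable_intervalMap,
    measurePreserving_intervalMap.map_eq]

theorem ergodic_mannevilleMap : Ergodic mannevilleMap leb := by
  refine ⟨measurePreserving_mannevilleMap, ⟨fun s hs hinv => ?_⟩⟩
  have h := volume_invariant_eq_zero (measurable_coe hs) fun t ht => by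
    rw [mem_preimage, ← mannevilleMap_coe ht, ← mem_preimage (f := mannevilleMap), hinv]
    rfl
  rw [eventuallyConst_set', ae_eq_empty, ae_eq_univ, leb_apply hs, leb_apply hs.compl]
  refine h.imp (fun h => ?_) (fun h => ?_)
  · rw [h, mul_zero]
  · rw [preimage_compl, h, mul_zero]

/-! ### Slow recurrence -/

theorem infDist_excSet_le_one (x : S1) : Metric.infDist x excSet ≤ 1 := by
  obtain ⟨t, ht, rfl⟩ := exists_coe_eq_of_Ico x
  rw [infDist_excSet_coe (Ico_subset_Icc_self ht)]
  exact (min_le_left _ _).trans (abs_le.mpr (Ico_subset_Icc_self ht))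

theorem integrable_log_infDist : Integrable (fun x => Real.log (Metric.infDist x excSet)) leb := by
  have hm : Measurable fun x : S1 => Real.log (Metric.infDist x excSet) :=
    Real.measurable_log.comp (Metric.continuous_infDist_pt _).measurable
  rw [leb_eq_map]
  refine Integrable.smul_measure ?_ (by simp)
  rw [integrable_map_measure hm.aestronglyMeasurable measurable_coe.aemeasurable]
  have conv : ∀ {φ : ℝ → ℝ}, IntervalIntegrable φ volume (-1) 1 →
      IntegrableOn (fun t => |φ t|) (Icc (-1 : ℝ) 1) := fun h =>
    ((intervalIntegrable_iff_integrableOn_Icc_of_le (by norm_num)).mp h).abs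
  have i0 : IntervalIntegrable (fun t => Real.log t) volume (-1) 1 :=
    intervalIntegral.intervalIntegrable_log'
  have i1 : IntervalIntegrable (fun t => Real.log (1 - t)) volume (-1) 1 := by
    have : IntervalIntegrable Real.log volume (1 - (-1)) (1 - 1) :=
      intervalIntegral.intervalIntegrable_log'
    simpa using this.comp_sub_left 1
  have i2 : IntervalIntegrable (fun t => Real.log (1 + t)) volume (-1) 1 := by
    have : IntervalIntegrable Real.log volume (1 + (-1)) (1 + 1) :=
      intervalIntegral.intervalIntegrable_log'
    simpa using this.comp_add_left 1
  -- The distance to the set is one of `|t|`, `1 - t`, `1 + t`, so the three logarithms together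
  -- dominate.
  refine Integrable.mono' (((conv i0).add (conv i1)).add (conv i2))
    (hm.comp measurable_coe).aestronglyMeasurable
    ((ae_restrict_iff' measurableSet_Icc).mpr (ae_of_all _ fun t ht => ?_))
  simp only [Function.comp_apply, Pi.add_apply, Real.norm_eq_abs]
  rw [infDist_excSet_coe ht]
  have a0 := abs_nonneg (Real.log t)
  have a1 := abs_nonneg (Real.log (1 - t))
  have a2 := abs_nonneg (Real.log (1 + t))
  rcases min_choice |t| (1 - |t|) with h | h
  · rw [h, Real.log_abs]
    linarith
  · rw [h]
    rcases abs_choice t with h' | h' <;> rw [h']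
    · linarith
    · rw [sub_neg_eq_add]
      linarith

theorem log_truncDist (δ : ℝ) (x : S1) : -Real.log (truncDist δ x excSet) =
    {x | Metric.infDist x excSet ≤ δ}.indicator
      (fun x => -Real.log (Metric.infDist x excSet)) x := by
  unfold truncDist
  by_cases h : Metric.infDist x excSet ≤ δ
  · rw [if_pos h, indicator_of_mem (by exact h)]
  · rw [if_neg h, indicator_of_notMem (by exact h), Real.log_one, neg_zero]

theorem measurableSet_infDist_le (δ : ℝ) : MeasurableSet {x : S1 | Metric.infDist x excSet ≤ δ} :=
  (isClosed_le (Metric.continuous_infDist_pt _) continuous_const).measurableSet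

theorem measurable_log_truncDist (δ : ℝ) :
    Measurable fun x => -Real.log (truncDist δ x excSet) := by
  simp_rw [log_truncDist]
  exact (Real.measurable_log.comp (Metric.continuous_infDist_pt _).measurable).neg.indicator
    (measurableSet_infDist_le δ)

theorem integrable_log_truncDist (δ : ℝ) :
    Integrable (fun x => -Real.log (truncDist δ x excSet)) leb := by
  simp_rw [log_truncDist]
  exact integrable_log_infDist.neg.indicator (measurableSet_infDist_le δ)

theorem exists_integral_log_truncDist_lt {ε : ℝ} (hε : 0 < ε) :
    ∃ δ > 0, ∫ x, -Real.log (truncDist δ x excSet) ∂leb < ε := by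
  have hlim : Tendsto (fun n : ℕ => ∫ x, -Real.log (truncDist (1 / ((n : ℝ) + 1)) x excSet) ∂leb)
      atTop (𝓝 (∫ _x : S1, (0 : ℝ) ∂leb)) := by
    refine tendsto_integral_of_dominated_convergence
      (fun x => |Real.log (Metric.infDist x excSet)|)
      (fun n => (measurable_log_truncDist _).aestronglyMeasurable) integrable_log_infDist.abs
      (fun n => ae_of_all _ fun x => ?_) (ae_of_all _ fun x => ?_)
    · rw [log_truncDist]
      refine (norm_indicator_le_norm_self _ _).trans_eq ?_
      rw [Real.norm_eq_abs, abs_neg]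
    · rcases (Metric.infDist_nonneg (x := x) (s := excSet)).eq_or_lt with h | h
      · refine tendsto_const_nhds.congr fun n => ?_
        -- On the set itself the integrand vanishes by the convention `log 0 = 0`.
        rw [truncDist, if_pos (by rw [← h]; positivity), ← h, Real.log_zero, neg_zero]
      · refine tendsto_const_nhds.congr' ?_
        filter_upwards [tendsto_one_div_add_atTop_nhds_zero_nat.eventually_lt_const h] with n hn
        rw [truncDist, if_neg (not_le.mpr hn), Real.log_one, neg_zero]
  rw [integral_zero] at hlim
  obtain ⟨n, hn⟩ := (hlim.eventually_lt_const hε).exists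
  exact ⟨_, by positivity, hn⟩

theorem leb_excSet : leb excSet = 0 := by
  have hfin : excSet.Finite := isNondegenerateExceptionalSet_excSet.finite
  rw [leb_apply hfin.measurableSet, Measure.restrict_apply (measurable_coe hfin.measurableSet)]
  refine mul_eq_zero_of_right _ ?_
  have hsub : ((↑) : ℝ → S1) ⁻¹' excSet ∩ Icc (-1 : ℝ) 1 ⊆ ({0, 1, -1} : Set ℝ) := by
    rintro t ⟨ht, htI⟩
    rcases (coe_mem_excSet_iff htI).mp ht with h | h
    · simp [h]
    · rcases (abs_eq zero_le_one).mp h with h | h <;> simp [h]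
  exact (Set.Finite.subset (by simp) hsub).measure_zero _

/-- For such points all truncated distances are positive, so bounds on their logarithms give bounds
on the distances. -/
theorem ae_iterate_notMem_excSet : ∀ᵐ x ∂leb, ∀ n : ℕ, mannevilleMap^[n] x ∉ excSet := by
  rw [ae_all_iff]
  intro n
  exact (measurePreserving_mannevilleMap.iterate n).quasiMeasurePreserving.ae
    (p := fun y => y ∉ excSet) (measure_eq_zero_iff_ae_notMem.mp leb_excSet)

/-! ### Positive frequency of hyperbolic times -/

/-- The neighbourhood of `0` in which the derivative is at least `2`. -/
def expandingSet : Set S1 := Metric.closedBall ((0 : ℝ) : S1) (1 / 4)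

theorem leb_expandingSet : leb.real expandingSet = 1 / 4 := by
  have h := AddCircle.volume_closedBall 2 (x := ((0 : ℝ) : S1)) (1 / 4)
  rw [AddCircle.volume_eq_smul_haarAddCircle, Measure.smul_apply, smul_eq_mul] at h
  have h2 := congrArg ENNReal.toReal h
  rw [ENNReal.toReal_mul, ENNReal.toReal_ofReal two_pos.le, ENNReal.toReal_ofReal (by norm_num),
    min_eq_right (by norm_num)] at h2
  rw [measureReal_def, expandingSet]
  linarith

theorem invDerivNorm_le_exp (x : S1) : invDerivNorm mannevilleMap x ≤
    Real.exp (-(Real.log 2 * expandingSet.indicator (fun _ => (1 : ℝ)) x)) := by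
  obtain ⟨t, ht, rfl⟩ := exists_coe_eq_of_Ico x
  have ht' := Ico_subset_Icc_self ht
  rw [invDerivNorm_coe ht']
  by_cases h : (t : S1) ∈ expandingSet
  · rw [indicator_of_mem h, mul_one, Real.exp_neg, Real.exp_log two_pos]
    rw [expandingSet, Metric.mem_closedBall, dist_coe_zero ht'] at h
    exact Real.sqrt_le_iff.mpr ⟨by norm_num, by linarith⟩
  · rw [indicator_of_notMem h, mul_zero, neg_zero, Real.exp_zero]
    exact Real.sqrt_le_one.mpr (abs_le.mpr ht')

/-- At a record, at least `k / 16` of the last `k` points lie in `expandingSet`. Each contributes a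
factor at most `1/2` and the others at most `1`, so the product is at most `2 ^ (-k / 16) = exp (-L)
^ k`. The hypothesis `hsh` is the distance condition after taking logarithms. -/
theorem isHyperbolicTime_of_record {b L δ : ℝ} {x : S1} {n : ℕ} (hb : 0 < b)
    (hL : L = Real.log 2 / 16) (hx : ∀ n : ℕ, mannevilleMap^[n] x ∉ excSet)
    (hrec : ∀ j < n,
      ∑ i ∈ Finset.range j, (expandingSet.indicator (fun _ => (1 : ℝ)) (mannevilleMap^[i] x) - 1 / 16)
      ≤ ∑ i ∈ Finset.range n,
        (expandingSet.indicator (fun _ => (1 : ℝ)) (mannevilleMap^[i] x) - 1 / 16))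
    (hsh : ¬ ∃ j < n,
      ((n - j : ℕ) : ℝ) < -Real.log (truncDist δ (mannevilleMap^[j] x) excSet) / (b * L)) :
    IsHyperbolicTime mannevilleMap excSet b (Real.exp (-L)) δ n x := by
  have hlog2 : 0 < Real.log 2 := Real.log_pos one_lt_two
  have hL0 : 0 < L := by rw [hL]; positivity
  intro k hk1 hkn
  constructor
  · have h1 := hrec (n - k) (by omega)
    rw [← Finset.sum_range_add_sum_Ico _ (Nat.sub_le n k), le_add_iff_nonneg_right,
      Finset.sum_sub_distrib, Finset.sum_const, Nat.card_Ico, Nat.sub_sub_self hkn,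
      nsmul_eq_mul] at h1
    calc _ ≤ ∏ j ∈ Finset.Ico (n - k) n, Real.exp (-(Real.log 2 *
          expandingSet.indicator (fun _ => (1 : ℝ)) (mannevilleMap^[j] x))) :=
          Finset.prod_le_prod (fun j _ => inv_nonneg.mpr (abs_nonneg _))
            fun j _ => invDerivNorm_le_exp _
      _ = Real.exp (-(Real.log 2 * ∑ j ∈ Finset.Ico (n - k) n,
          expandingSet.indicator (fun _ => (1 : ℝ)) (mannevilleMap^[j] x))) := by
          rw [← Real.exp_sum, Finset.sum_neg_distrib, Finset.mul_sum]
      _ ≤ Real.exp (-L) ^ k := by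
          rw [← Real.exp_nat_mul, Real.exp_le_exp, hL]
          nlinarith
  · push Not at hsh
    have h1 := hsh (n - k) (by omega)
    rw [Nat.sub_sub_self hkn, div_le_iff₀ (by positivity)] at h1
    have hpos : 0 < truncDist δ (mannevilleMap^[n - k] x) excSet := by
      unfold truncDist
      split_ifs
      · refine (Metric.infDist_nonneg).lt_of_ne fun h => hx (n - k) ?_
        exact (isNondegenerateExceptionalSet_excSet.finite.isClosed.mem_iff_infDist_zero
          ⟨_, mem_insert _ _⟩).mpr h.symm
      · exact one_pos
    rw [← Real.exp_mul, ← Real.le_log_iff_exp_le hpos]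
    linarith

theorem frequencyGreaterThan_of_bounds {b L δ M₁ M₂ : ℝ} {x : S1} (hb : 0 < b)
    (hL : L = Real.log 2 / 16) (hx : ∀ n : ℕ, mannevilleMap^[n] x ∉ excSet)
    (h₁ : ∀ n, birkhoffSum mannevilleMap
      (fun x => 1 / 8 - expandingSet.indicator (fun _ => (1 : ℝ)) x) n x ≤ M₁)
    (h₂ : ∀ n, birkhoffSum mannevilleMap
      (fun x => -Real.log (truncDist δ x excSet) - b * L / 64) n x ≤ M₂) :
    FrequencyGreaterThan mannevilleMap excSet b (Real.exp (-L)) δ (1 / 32) x := by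
  classical
  have hlog2 : 0 < Real.log 2 := Real.log_pos one_lt_two
  have hL0 : 0 < L := by rw [hL]; positivity
  have hbL : 0 < b * L := by positivity
  set v : ℕ → ℝ := fun i => expandingSet.indicator (fun _ => (1 : ℝ)) (mannevilleMap^[i] x) with hv
  set r : ℕ → ℝ := fun j => -Real.log (truncDist δ (mannevilleMap^[j] x) excSet) / (b * L) with hr
  have hr0 : ∀ j, 0 ≤ r j := by
    intro j
    refine div_nonneg (neg_nonneg.mpr (Real.log_nonpos ?_ ?_)) hbL.le
    · unfold truncDist
      split_ifs
      · exact Metric.infDist_nonneg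
      · exact zero_le_one
    · unfold truncDist
      split_ifs
      · exact infDist_excSet_le_one _
      · exact le_rfl
  have hv1 : ∀ i, v i ≤ 1 := fun i => indicator_le_self' (fun _ _ => zero_le_one) _
  -- There are at least `N / 16 - M₁` records and at most `N / 64 + M₂ / (b * L)` shadowed times.
  -- The difference `3 * N / 64 - (M₁ + M₂ / (b * L))` is at least `N / 32` for these `N`.
  filter_upwards [eventually_ge_atTop ⌈64 * (M₁ + M₂ / (b * L))⌉₊] with N hN
  have hN' := Nat.ceil_le.mp hN
  have hrecords := le_card_records (S := fun n => ∑ i ∈ Finset.range n, (v i - 1 / 16)) (by simp)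
    (fun n => by
      simp only [Finset.sum_range_succ]
      linarith [hv1 n]) N N le_rfl
  have hshadow := card_shadowed_le hr0 N
  set R := (Finset.Icc 1 N).filter fun n => ∀ j < n,
    ∑ i ∈ Finset.range j, (v i - 1 / 16) ≤ ∑ i ∈ Finset.range n, (v i - 1 / 16) with hR
  set B := (Finset.Icc 1 N).filter fun n => ∃ j < n, ((n - j : ℕ) : ℝ) < r j with hB
  set H := {m : ℕ | 1 ≤ m ∧ m ≤ N ∧
    IsHyperbolicTime mannevilleMap excSet b (Real.exp (-L)) δ m x} with hH
  have hHfin : H.Finite := (Finset.Icc 1 N).finite_toSet.subset fun m hm => by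
    simpa using ⟨hm.1, hm.2.1⟩
  have hsub : ((R \ B : Finset ℕ) : Set ℕ) ⊆ H := by
    intro n hn
    simp only [Finset.coe_sdiff, Set.mem_sdiff, Finset.mem_coe, hR, hB, Finset.mem_filter,
      Finset.mem_Icc, not_and] at hn
    obtain ⟨⟨hn1, hn2⟩, hn3⟩ := hn
    exact ⟨hn1.1, hn1.2, isHyperbolicTime_of_record hb hL hx hn2 (hn3 hn1)⟩
  have hcard : (R.card : ℝ) ≤ H.ncard + B.card := by
    have h3 := ncard_le_ncard hsub hHfin
    rw [ncard_coe_finset] at h3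
    have h4 := Finset.card_le_card_sdiff_add_card (s := R) (t := B)
    exact_mod_cast h4.trans (by omega)
  have e1 := h₁ N
  have e2 := h₂ N
  simp only [birkhoffSum, Finset.sum_sub_distrib, Finset.sum_const, Finset.card_range,
    nsmul_eq_mul] at e1 e2 hrecords
  have e3 : ∑ j ∈ Finset.range N, r j ≤ N / 64 + M₂ / (b * L) := by
    rw [hr, ← Finset.sum_div, div_le_iff₀ hbL, add_mul, div_mul_cancel₀ _ hbL.ne']
    linarith
  linarith

theorem exists_frequencyGreaterThan {b : ℝ} (hb : 0 < b) :
    ∃ σ δ θ : ℝ, 0 < σ ∧ σ < 1 ∧ 0 < δ ∧ 0 < θ ∧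
      ∀ᵐ x ∂leb, FrequencyGreaterThan mannevilleMap excSet b σ δ θ x := by
  set L : ℝ := Real.log 2 / 16 with hL
  have hL0 : 0 < L := by
    have := Real.log_pos one_lt_two
    positivity
  -- With this `δ` the mean shadow length is below `1/64`; on the other side, `1/8` lies below the
  -- measure `1/4` of `expandingSet`.
  obtain ⟨δ, hδ, hlt⟩ := exists_integral_log_truncDist_lt (show 0 < b * L / 64 by positivity)
  refine ⟨Real.exp (-L), δ, 1 / 32, Real.exp_pos _, Real.exp_lt_one_iff.mpr (by linarith), hδ,
    by norm_num, ?_⟩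
  have hE : MeasurableSet expandingSet := Metric.isClosed_closedBall.measurableSet
  have hind : Integrable (expandingSet.indicator fun _ => (1 : ℝ)) leb :=
    (integrable_const 1).indicator hE
  have a1 := ae_bddAbove_birkhoffSum ergodic_mannevilleMap
    (u := fun x => 1 / 8 - expandingSet.indicator (fun _ => (1 : ℝ)) x)
    (measurable_const.sub (measurable_const.indicator hE)) ((integrable_const _).sub hind) (by
      rw [integral_sub (integrable_const _) hind]
      have := integral_indicator_one (μ := leb) hE
      rw [leb_expandingSet] at this
      rw [integral_const, probReal_univ, one_smul]
      refine (sub_neg).mpr (lt_of_lt_of_eq ?_ this.symm)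
      norm_num)
  have a2 := ae_bddAbove_birkhoffSum ergodic_mannevilleMap
    (u := fun x => -Real.log (truncDist δ x excSet) - b * L / 64)
    ((measurable_log_truncDist δ).sub measurable_const)
    ((integrable_log_truncDist δ).sub (integrable_const _)) (by
      rw [integral_sub (integrable_log_truncDist δ) (integrable_const _), integral_const,
        probReal_univ, one_smul]
      linarith)
  filter_upwards [a1, a2, ae_iterate_notMem_excSet] with x ⟨M₁, h₁⟩ ⟨M₂, h₂⟩ hx
  exact frequencyGreaterThan_of_bounds hb hL hx (fun n => h₁ ⟨n, rfl⟩) fun n => h₂ ⟨n, rfl⟩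

/-! ### Non-integrability of the first hyperbolic time -/

/-- The distance to the neutral point evolves by `t ↦ 2 - 2√(1 - t)`, which is `t + t² / 4` to
second order; the sequence `c / (n + 1)` grows faster in backward `n` and is a barrier. -/
theorem mannevilleMap_one_sub {c t : ℝ} {n : ℕ} (hc : c < 1) (ht0 : 0 ≤ t)
    (ht : t < c / ((n : ℝ) + 2)) :
    ∃ t' : ℝ, 0 ≤ t' ∧ t' < c / ((n : ℝ) + 1) ∧
      mannevilleMap ((1 - t : ℝ) : S1) = ((1 - t' : ℝ) : S1) := by
  have hn : (0 : ℝ) ≤ n := n.cast_nonneg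
  rw [lt_div_iff₀ (by positivity)] at ht
  have ht1 : t < 1 := by nlinarith
  refine ⟨2 - 2 * √(1 - t), ?_, ?_, ?_⟩
  · have : √(1 - t) ≤ 1 := Real.sqrt_le_one.mpr (by linarith)
    linarith
  · set τ := c / ((n : ℝ) + 1) with hτ
    have hτc : τ * ((n : ℝ) + 1) = c := div_mul_cancel₀ _ (by positivity)
    have hc0 : 0 < c := lt_of_le_of_lt (by positivity) ht
    have hτ0 : 0 < τ := by positivity
    have hτ1 : τ * ((n : ℝ) + 2) ≤ 2 := by nlinarith
    -- Squaring reduces this to `t < τ - τ ^ 2 / 4`; after multiplication by `n + 2`, `hτ1` bounds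
    -- the quadratic term by `τ / 2`, within the available gap `τ`.
    have hlt : 1 - τ / 2 < √(1 - t) := by
      refine Real.lt_sqrt_of_sq_lt ?_
      have h1 : t * ((n : ℝ) + 2) < (τ - τ ^ 2 / 4) * ((n : ℝ) + 2) := by nlinarith
      have := lt_of_mul_lt_mul_right h1 (by positivity)
      nlinarith
    linarith
  · rw [mannevilleMap_coe ⟨by linarith, by linarith⟩, intervalMap_of_nonneg (by linarith)]
    congr 1
    ring

theorem iterate_mannevilleMap_one_sub {c : ℝ} (hc : c < 1) (n : ℕ) :
    ∀ t : ℝ, 0 ≤ t → t < c / ((n : ℝ) + 1) →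
      ∃ s : ℝ, 0 ≤ s ∧ s < c ∧ mannevilleMap^[n] ((1 - t : ℝ) : S1) = ((1 - s : ℝ) : S1) := by
  induction n with
  | zero => exact fun t h0 h => ⟨t, h0, by simpa using h, rfl⟩
  | succ n ih =>
    intro t h0 h
    push_cast at h
    rw [add_assoc, one_add_one_eq_two] at h
    obtain ⟨t', h0', h', e⟩ := mannevilleMap_one_sub hc h0 h
    obtain ⟨s, hs0, hs, e'⟩ := ih t' h0' h'
    exact ⟨s, hs0, hs, by rw [Function.iterate_succ_apply, e, e']⟩

theorem le_firstHyperbolicTime {b σ δ t : ℝ} (hσ0 : 0 < σ) (ht0 : 0 < t) :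
    ENNReal.ofReal ((1 - σ ^ 2) / t) ≤
      firstHyperbolicTime mannevilleMap excSet b σ δ ((1 - t : ℝ) : S1) := by
  refine le_iInf₂ fun m ⟨hm1, hm⟩ => ?_
  rw [← ENNReal.ofReal_natCast]
  refine ENNReal.ofReal_le_ofReal ?_
  by_contra! hlt
  obtain ⟨n, rfl⟩ := Nat.exists_eq_add_of_le' hm1
  -- The condition for `k = 1` suffices: the last derivative must be at least `1 / σ`, which forces
  -- a distance of at least `1 - σ ^ 2` from the neutral point.
  have h1 := (hm 1 le_rfl (by omega)).1
  rw [Nat.add_sub_cancel, Nat.Ico_succ_singleton, Finset.prod_singleton, pow_one] at h1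
  push_cast at hlt
  have hn : (0 : ℝ) < (n : ℝ) + 1 := by positivity
  have hlt' : t < (1 - σ ^ 2) / ((n : ℝ) + 1) := by
    rw [lt_div_iff₀ ht0] at hlt
    rw [lt_div_iff₀ hn]
    linarith
  have hσ2 : 0 < σ ^ 2 := by positivity
  obtain ⟨s, hs0, hs, e⟩ := iterate_mannevilleMap_one_sub (by linarith) n t ht0.le hlt'
  rw [e, invDerivNorm_coe ⟨by linarith, by linarith⟩, abs_of_pos (by linarith),
    Real.sqrt_le_left hσ0.le] at h1
  linarith

theorem lintegral_firstHyperbolicTime {b σ δ : ℝ} (hσ0 : 0 < σ) (hσ1 : σ < 1) :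
    ∫⁻ x, firstHyperbolicTime mannevilleMap excSet b σ δ x ∂leb = ∞ := by
  set h := firstHyperbolicTime mannevilleMap excSet b σ δ
  have hc : 0 < 1 - σ ^ 2 := by nlinarith
  have hvol : ∫⁻ x, h x ∂volume = 2 * ∫⁻ x, h x ∂leb := by
    rw [AddCircle.volume_eq_smul_haarAddCircle, lintegral_smul_measure, smul_eq_mul,
      ENNReal.ofReal_ofNat]
  have hlow : ∫⁻ u in Ioc (0 : ℝ) 1, ENNReal.ofReal ((1 - σ ^ 2) / (1 - u)) ≤ ∫⁻ x, h x ∂volume := by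
    rw [← AddCircle.lintegral_preimage 2 (-1), show (-1 : ℝ) + 2 = 1 by norm_num]
    refine le_trans ?_ (lintegral_mono_set (Ioc_subset_Ioc_left (by norm_num : (-1 : ℝ) ≤ 0)))
    refine setLIntegral_mono' measurableSet_Ioc fun u hu => ?_
    rcases hu.2.eq_or_lt with rfl | hu1
    -- At `u = 1` the lower bound is a division by zero, hence `0`.
    · simp
    · have := le_firstHyperbolicTime (b := b) (δ := δ) hσ0 (sub_pos.mpr hu1)
      rwa [sub_sub_cancel] at this
  have htop : ∫⁻ u in Ioc (0 : ℝ) 1, ENNReal.ofReal ((1 - σ ^ 2) / (1 - u)) = ∞ := by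
    by_contra hne
    rw [← Ne, lintegral_ofReal_ne_top_iff_integrable
      (by fun_prop : Measurable fun u : ℝ => (1 - σ ^ 2) / (1 - u)).aestronglyMeasurable
      ((ae_restrict_iff' measurableSet_Ioc).mpr (ae_of_all _ fun u hu =>
        div_nonneg hc.le (sub_nonneg.mpr hu.2)))] at hne
    -- Rescaled, finiteness would make the simple pole at the endpoint `1` integrable.
    have h2 : IntervalIntegrable (fun u : ℝ => (u - 1)⁻¹) volume 0 1 := by
      rw [intervalIntegrable_iff_integrableOn_Ioc_of_le zero_le_one]
      refine (hne.const_mul (-(1 - σ ^ 2)⁻¹)).congr (ae_of_all _ fun u => ?_)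
      simp only
      rw [← neg_sub 1 u, inv_neg]
      field_simp
    rw [intervalIntegrable_sub_inv_iff] at h2
    simp at h2
  rw [htop, hvol, top_le_iff] at hlow
  by_contra hne
  exact ENNReal.mul_ne_top ENNReal.ofNat_ne_top hne hlow

end HyperbolicTimes

open HyperbolicTimes
theorem mainTheorem4 :
    -- the map is a continuous local homeomorphism, differentiable exactly off `0`
    (IsLocalHomeomorph mannevilleMap ∧
      (∀ x : S1, DifferentiableAt ℝ (chartExpr mannevilleMap x) 0 ↔
        x ≠ ((0 : ℝ) : S1))) ∧
    -- the exceptional set is the set where it fails to be a `C²` local diffeomorphism,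
    -- and it is non-degenerate
    (∀ x : S1, x ∈ excSet ↔ ¬ IsC2LocalDiffeoAt mannevilleMap x) ∧
    (∃ B β : ℝ, IsNondegenerateExceptionalSet mannevilleMap excSet B β) ∧
    -- topological mixing; moreover every non-empty open set is eventually mapped onto the circle
    IsTopologicallyMixing mannevilleMap ∧
    (∀ J : Set S1, IsOpen J → J.Nonempty → ∃ N : ℕ, mannevilleMap^[N] '' J = univ) ∧
    -- invariance of Lebesgue measure
    MeasurePreserving mannevilleMap leb leb ∧
    -- for every admissible exponent `b` in the definition of hyperbolic times
    (∀ B β b : ℝ, IsNondegenerateExceptionalSet mannevilleMap excSet B β →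
      0 < b → b < min (1 / 2) (1 / (4 * β)) →
      -- positive frequency of hyperbolic times
      (∃ σ δ θ : ℝ, 0 < σ ∧ σ < 1 ∧ 0 < δ ∧ 0 < θ ∧
        ∀ᵐ x ∂leb, FrequencyGreaterThan mannevilleMap excSet b σ δ θ x) ∧
      -- the first hyperbolic time map is never integrable
      (∀ σ δ : ℝ, 0 < σ → σ < 1 → 0 < δ →
        ∫⁻ x, firstHyperbolicTime mannevilleMap excSet b σ δ x ∂leb = ∞)) := by
  exact ⟨⟨isLocalHomeomorph_mannevilleMap, differentiableAt_chartExpr_iff⟩, mem_excSet_iff,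
    ⟨2, 1, isNondegenerateExceptionalSet_excSet⟩, isTopologicallyMixing_mannevilleMap,
    fun _ hJ hne => exists_iterate_image_eq_univ hJ hne, measurePreserving_mannevilleMap,
    fun _ _ _ _ hb _ => ⟨exists_frequencyGreaterThan hb,
      fun _ _ hσ0 hσ1 _ => lintegral_firstHyperbolicTime hσ0 hσ1⟩⟩
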